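/- All logarithms are natural and all alphabets are finite. Let $P_{Y|X}=P_{Z|X}$ be a channel from $\mathcal X$ to $\mathcal Y=\mathcal Z$ such that each output letter has positive probability for some input. Given $X=x$ let $Y,Z$ be independent, each with law $P_{Z|X=x}$; this defines the channel $P_{YZ|X}$. Let $Q_{YZ}$ be its capacity-achieving output distribution, i.e. the distribution attaining $\inf_{Q}\sup_{P_X} D(P_{YZ|X}\|Q|P_X)$, with marginals $Q_Y,Q_Z$. Call $z_1,z_2\in\mathcal Z$ equivalent if $Q_{Y|Z=z_1}=Q_{Y|Z=z_2}$, and let $\underline z$ be the class of $z$; define $\underline y$ likewise through $Q_{Z|Y}$. Let $$\mathcal X_{\rm bad}=\Big\{x:\ \exists\, z\ne z',\ \underline z=\underline z',\ \tfrac{P_{Z|X=x}(z)}{Q_Z(z)}\neq\tfrac{P_{Z|X=x}(z')}{Q_Z(z')}\Big\},$$ $$\Delta(\delta)=\sup\Big\{S_X(\mathcal X_{\rm bad}):\ D\Big(\sum_x P_{YZ|X=x}S_X(x)\,\Big\|\,Q_{YZ}\Big)\le\delta\Big\},$$ where the supremum is over distributions $S_X$ on $\mathcal X$, and let $\mu(\epsilon)=\epsilon\log|\mathcal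 X|+{\rm H}(\epsilon)$ with ${\rm H}$ the binary entropy function. Model 1 (blocklength $n$, rates $R,R_0>0$, $M=\lfloor e^{nR}\rfloor$): $W$ is uniform on $\{1,\dots,M\}$; the encoder maps $W$ to $X^n\in\mathcal X^n$; given $X^n$, the blocks $Y^n,Z^n$ are independent outputs of the memoryless channels $P_{Y|X},P_{Z|X}$; the relay sends $V=V(Z^n)\in\{1,\dots,\lfloor e^{nR_0}\rfloor\}$; the decoder outputs $\hat W=\hat W(V,Y^n)\in\{1,\dots,M\}$; and $P_e^{(n)}=\mathbb P[W\ne\hat W]$. All maps are deterministic. $C_\epsilon(R_0)$ is the supremum of the rates $R$ for which $\limsup_{n\to\infty}\inf P_e^{(n)}\le\epsilon$, the infimum being over all Model 1 codes with rates $R,R_0$; $C(R_0)=\lim_{\epsilon\downarrow0}C_\epsilon(R_0)$; and $C(\infty)$ is the same quantity with no limit on the number of relay messages. Model 2: as Model 1, but $V=V(\underline Z^n,E)$ and $\hat W=\hat W(V,\underline Y^n,E)$, where $\underline Y^n,\underline Z^n$ are the coordinatewise classes and the oracle $E=(E_1,\dots,E_n)$ has $E_i=X_i$ if $X_i\in\mathcal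 X_{\rm bad}$ and $E_i=*$ otherwise. **Proposition.** Let $R,R_0>0$, $n\ge1$, $\epsilon\in(0,1)$, $M=\lfloor e^{nR}\rfloor$. Suppose that some encoder, relay and decoder in Model 1 with parameters $R,R_0$ have $P_e^{(n)}\le\epsilon$. Then there are a relay and a decoder in Model 2 which, with the same encoder and the same parameters, have $P_e^{(n)}\le\epsilon$. Moreover, if $M\le|\mathcal X|^n$ (for instance if $R\le\log|\mathcal X|$), then the encoder output $X^n$ satisfies $$\frac1n\,\mathbb E\Big[\sum_{i=1}^n 1_{X_i\in\mathcal X_{\rm bad}}\Big]\le\Delta\Big(C(\infty)-\tfrac1n\log M+\mu(\epsilon)\Big).$$ (When $e^{nR}$ is an integer, $\frac1n\log M=R$.) -/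

import Mathlib

open Filter Topology
open scoped ENNReal

/-! Finite-alphabet probability. A distribution on `B` is an element of `stdSimplex ℝ B` and a
channel from `A` to `B` is a map `A → stdSimplex ℝ B`. All logarithms are natural. -/

namespace RelayChannel

noncomputable section

section Information

variable {A B Y Z : Type*} [Fintype A] [Fintype B] [Fintype Y] [Fintype Z]

/-- The probability measure, on the discrete σ-algebra, with mass function `p`. -/
def law (p : stdSimplex ℝ B) : @MeasureTheory.Measure B ⊤ :=
  letI : MeasurableSpace B := ⊤
  ∑ b, ENNReal.ofReal (p b) • MeasureTheory.Measure.dirac b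

/-- Relative entropy `D(p‖q)`; it is `∞` when `p` is not absolutely continuous w.r.t. `q`. -/
def relEntropy (p q : stdSimplex ℝ B) : ℝ≥0∞ :=
  @InformationTheory.klDiv B ⊤ (law p) (law q)

/-- The joint distribution of input and output, for input law `S` and channel `W`. -/
def joint (S : stdSimplex ℝ A) (W : A → stdSimplex ℝ B) : stdSimplex ℝ (A × B) :=
  ⟨fun ab => S ab.1 * W ab.1 ab.2,
    fun ab => mul_nonneg (S.2.1 ab.1) ((W ab.1).2.1 ab.2), by
      have h : ∀ a, ∑ b, S a * W a b = S a := fun a => by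
        rw [← Finset.mul_sum]
        exact (congrArg (S a * ·) (W a).2.2).trans (mul_one _)
      rw [Fintype.sum_prod_type]
      exact (Finset.sum_congr rfl fun a _ => h a).trans S.2.2⟩

/-- The output distribution `∑ₓ W(·|x) S(x)`. -/
def output (S : stdSimplex ℝ A) (W : A → stdSimplex ℝ B) : stdSimplex ℝ B :=
  ⟨fun b => ∑ a, S a * W a b,
    fun b => Finset.sum_nonneg fun a _ => mul_nonneg (S.2.1 a) ((W a).2.1 b), by
      rw [Finset.sum_comm]
      have h := (joint S W).2.2
      rw [Fintype.sum_prod_type] at h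
      exact h⟩

/-- Conditional relative entropy `D(W‖q|S)`, the divergence of the two joint laws. -/
def condRelEntropy (W : A → stdSimplex ℝ B) (q : stdSimplex ℝ B) (S : stdSimplex ℝ A) : ℝ≥0∞ :=
  relEntropy (joint S W) (joint S fun _ => q)

/-- `q` is a capacity-achieving output distribution of `W`: it attains
`inf_q sup_S D(W‖q|S)`. -/
def IsCapacityAchievingOutput (W : A → stdSimplex ℝ B) (q : stdSimplex ℝ B) : Prop :=
  ∀ q' : stdSimplex ℝ B, ⨆ S, condRelEntropy W q S ≤ ⨆ S, condRelEntropy W q' S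

/-- The channel `P_{YZ|X}` whose two outputs are conditionally independent given the input. -/
def prodChannel (PY : A → stdSimplex ℝ Y) (PZ : A → stdSimplex ℝ Z) :
    A → stdSimplex ℝ (Y × Z) :=
  fun a => joint (PY a) fun _ => PZ a

/-- Memoryless extension: the probability of the block `b` given the input block `a`. -/
def blockProb {n : ℕ} (W : A → stdSimplex ℝ B) (a : Fin n → A) (b : Fin n → B) : ℝ :=
  ∏ i, W (a i) (b i)

/-- The marginals of a joint distribution. -/
def margFst (Q : stdSimplex ℝ (Y × Z)) (y : Y) : ℝ := ∑ z, Q (y, z)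

/-- See `margFst`. -/
def margSnd (Q : stdSimplex ℝ (Y × Z)) (z : Z) : ℝ := ∑ y, Q (y, z)

/-- `y₁` and `y₂` are equivalent when `Q_{Z|Y=y₁} = Q_{Z|Y=y₂}`. -/
def eqvY (Q : stdSimplex ℝ (Y × Z)) : Setoid Y :=
  Setoid.ker fun y => fun z => Q (y, z) / margFst Q y

/-- `z₁` and `z₂` are equivalent when `Q_{Y|Z=z₁} = Q_{Y|Z=z₂}`. -/
def eqvZ (Q : stdSimplex ℝ (Y × Z)) : Setoid Z :=
  Setoid.ker fun z => fun y => Q (y, z) / margSnd Q z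

/-- The inputs `x` for which `P_{Z|X=x}/Q_Z` is not constant on some equivalence class. -/
def badInputs (PZ : A → stdSimplex ℝ Z) (Q : stdSimplex ℝ (Y × Z)) : Set A :=
  {x | ∃ z z', z ≠ z' ∧ eqvZ Q z z' ∧ PZ x z / margSnd Q z ≠ PZ x z' / margSnd Q z'}

/-- `Δ(δ)`: the largest probability of the bad inputs under an input law `S` whose output law
is within divergence `δ` of `Q`. (A subset of `[0,1]`; used where this set is nonempty.) -/
def Delta (PY : A → stdSimplex ℝ Y) (PZ : A → stdSimplex ℝ Z) (Q : stdSimplex ℝ (Y × Z))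
    (δ : ℝ) : ℝ :=
  sSup {t | ∃ S : stdSimplex ℝ A,
    ((relEntropy (output S (prodChannel PY PZ)) Q : ℝ≥0∞) : EReal) ≤ (δ : EReal) ∧
    t = ∑ x, (badInputs PZ Q).indicator (fun x => S x) x}

/-- `μ(ε) = ε log |𝒳| + H(ε)`. -/
def fanoTerm (A : Type*) [Fintype A] (ε : ℝ) : ℝ :=
  ε * Real.log (Fintype.card A) + Real.binEntropy ε

end Information

section Codes

/-- The number `⌊exp(nR)⌋` of messages. -/
def numMsg (n : ℕ) (R : ℝ) : ℕ := ⌊Real.exp (n * R)⌋₊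

/-- The set of relay messages: `⌊exp(nR₀)⌋` of them, and no limit when `R₀ = ∞`. -/
def RelayMsg (n : ℕ) : WithTop ℝ → Type
  | none => ℕ
  | some R₀ => Fin (numMsg n R₀)

/-- A block code for the relay channel. -/
structure Model1Code (X Y Z : Type*) (n : ℕ) (R : ℝ) (R₀ : WithTop ℝ) where
  enc : Fin (numMsg n R) → (Fin n → X)
  relay : (Fin n → Z) → RelayMsg n R₀
  dec : RelayMsg n R₀ → (Fin n → Y) → Fin (numMsg n R)

variable {X Y Z : Type*} [Fintype X] [Fintype Y] [Fintype Z] {n : ℕ} {R : ℝ} {R₀ : WithTop ℝ}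

/-- `ℙ[W ≠ Ŵ]` for a uniform message `W` sent by `enc`, the memoryless channels `PY` and `PZ`
conditionally independent given the input block, and `Ŵ = est Xⁿ Yⁿ Zⁿ`. -/
def errorOf (PY : X → stdSimplex ℝ Y) (PZ : X → stdSimplex ℝ Z) {M : ℕ}
    (enc : Fin M → (Fin n → X)) (est : (Fin n → X) → (Fin n → Y) → (Fin n → Z) → Fin M) : ℝ :=
  (M : ℝ)⁻¹ * ∑ w, ∑ y : Fin n → Y, ∑ z : Fin n → Z,
    blockProb PY (enc w) y * blockProb PZ (enc w) z * if est (enc w) y z = w then 0 else 1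

/-- The error probability of a code in Model 1. -/
def Model1Code.errorProb (c : Model1Code X Y Z n R R₀) (PY : X → stdSimplex ℝ Y)
    (PZ : X → stdSimplex ℝ Z) : ℝ :=
  errorOf PY PZ c.enc fun _ y z => c.dec (c.relay z) y

/-- `C_ε(R₀)`. (At `R = 0` there is a single message, so the set is nonempty.) -/
def epsCapacity (PY : X → stdSimplex ℝ Y) (PZ : X → stdSimplex ℝ Z) (R₀ : WithTop ℝ)
    (ε : ℝ) : ℝ :=
  sSup {R | 0 ≤ R ∧
    limsup (fun n : ℕ => ⨅ c : Model1Code X Y Z n R R₀, c.errorProb PY PZ) atTop ≤ ε}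

/-- `C(R₀)`, the limit of `C_ε(R₀)` as `ε ↓ 0`. -/
def capacity (PY : X → stdSimplex ℝ Y) (PZ : X → stdSimplex ℝ Z) (R₀ : WithTop ℝ) : ℝ :=
  limUnder (𝓝[>] (0 : ℝ)) fun ε => epsCapacity PY PZ R₀ ε

open Classical in
/-- The oracle: it reveals the bad input symbols; `none` is the dummy symbol. -/
def oracle (PZ : X → stdSimplex ℝ Z) (Q : stdSimplex ℝ (Y × Z)) (x : Fin n → X) :
    Fin n → Option X :=
  fun i => if x i ∈ badInputs PZ Q then some (x i) else none

/-- A block code for the model where the channel outputs are only seen through their equivalence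
classes, and relay and decoder are also given the oracle sequence. -/
structure Model2Code (X : Type*) {Y Z : Type*} [Fintype Y] [Fintype Z]
    (Q : stdSimplex ℝ (Y × Z)) (n : ℕ) (R : ℝ) (R₀ : WithTop ℝ) where
  enc : Fin (numMsg n R) → (Fin n → X)
  relay : (Fin n → Quotient (eqvZ Q)) → (Fin n → Option X) → RelayMsg n R₀
  dec : RelayMsg n R₀ → (Fin n → Quotient (eqvY Q)) → (Fin n → Option X) → Fin (numMsg n R)

/-- The error probability of a code in Model 2. -/
def Model2Code.errorProb {Q : stdSimplex ℝ (Y × Z)} (c : Model2Code X Q n R R₀)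
    (PY : X → stdSimplex ℝ Y) (PZ : X → stdSimplex ℝ Z) : ℝ :=
  errorOf PY PZ c.enc fun x y z =>
    c.dec (c.relay (fun i => Quotient.mk (eqvZ Q) (z i)) (oracle PZ Q x))
      (fun i => Quotient.mk (eqvY Q) (y i)) (oracle PZ Q x)

/-- `(1/n) 𝔼[∑ᵢ 1{Xᵢ bad}]`, where `Xⁿ` is the codeword of a uniform message. -/
def badFraction (PZ : X → stdSimplex ℝ Z) (Q : stdSimplex ℝ (Y × Z)) {M : ℕ}
    (enc : Fin M → (Fin n → X)) : ℝ :=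
  (n : ℝ)⁻¹ * ((M : ℝ)⁻¹ * ∑ w, ∑ i, (badInputs PZ Q).indicator (fun _ => (1 : ℝ)) (enc w i))

end Codes

end

end RelayChannel

/-! Simulation. If `x` is not bad, `P x z / Q_Z z` depends only on the class of `z`, so `P x z` is
`Q_Z z` times a function of `x` and the class. If `x` is bad, the oracle reveals it. In both cases
the law of `z` given its class and the oracle letter is free of the message, so Model 2 could
resample the lost block. A best deterministic choice does no worse than resampling. This is done for
the relay and then for the decoder (`exists_deterministic_choice`, `exists_factorization`,
`exists_model2Code`). The decoder's side uses the symmetry of `Q`, which holds because `Q` is an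
output law of a channel with two equal components.

Bad letters. Let `S` be the empirical letter law of the codebook, `W` the product channel and `T`
its output law under `S`. Then `badFraction` is the `S`-mass of the bad inputs, so it suffices to
bound `D(T‖Q)`. The optimality conditions give `D(W x‖Q) ≤ max I` for every `x`
(`klSum_le_of_isMax`), and averaging over `S` gives `I(S) + D(T‖Q) ≤ max I` (`sum_klSum_eq`). Fano's
inequality (`log_card_le_of_error`), with `log M ≤ n log |X|`, gives `I(S) ≥ log M / n - μ(ε)`. As
`C(∞)` is defined operationally, `max I ≤ C(∞)` is still needed. This is the direct coding theorem,
obtained from Feinstein's lemma (`mutInfo_le_capacity`). -/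

namespace RelayChannel

/-! ### Gibbs' inequality for finite sums -/

/-- The relative entropy `∑ p (log p - log q)` as a real sum. -/
noncomputable def klSum {B : Type*} [Fintype B] (p q : B → ℝ) : ℝ :=
  ∑ b, p b * (Real.log (p b) - Real.log (q b))

/-- This is `log u ≤ u - 1` at `u = r / p`. Being pointwise, it also serves references of mass below
one, as in Fano's inequality. -/
theorem log_div_mul_le {p r : ℝ} (hp : 0 ≤ p) (hr : 0 ≤ r) (h : r = 0 → p = 0) :
    p - r ≤ p * (Real.log p - Real.log r) := by
  rcases hp.eq_or_lt with rfl | hp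
  · simpa using hr
  have hr : 0 < r := hr.lt_of_ne fun h' => hp.ne' (h h'.symm)
  have := Real.log_le_sub_one_of_pos (div_pos hr hp)
  rw [Real.log_div hr.ne' hp.ne'] at this
  have := mul_le_mul_of_nonneg_left this hp.le
  rw [mul_sub, mul_sub, mul_div_cancel₀ _ hp.ne'] at this
  linarith

/-- Gibbs' inequality. -/
theorem klSum_nonneg {B : Type*} [Fintype B] {p r : B → ℝ} (hp : ∀ b, 0 ≤ p b)
    (hr : ∀ b, 0 ≤ r b) (h : ∀ b, r b = 0 → p b = 0) (hpr : ∑ b, r b ≤ ∑ b, p b) :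
    0 ≤ klSum p r := by
  have : ∑ b, (p b - r b) ≤ klSum p r :=
    Finset.sum_le_sum fun b _ => log_div_mul_le (hp b) (hr b) (h b)
  rw [Finset.sum_sub_distrib] at this
  linarith

/-! ### Relative entropy of measures as a finite sum -/

section Bridge

variable {B : Type*} [Fintype B]

theorem lintegral_law (p : stdSimplex ℝ B) (f : B → ℝ≥0∞) :
    @MeasureTheory.lintegral B ⊤ (law p) f = ∑ b, ENNReal.ofReal (p b) * f b := by
  let _ : MeasurableSpace B := ⊤
  unfold law
  rw [MeasureTheory.lintegral_finsetSum_measure]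
  refine Finset.sum_congr rfl fun b _ => ?_
  rw [MeasureTheory.lintegral_smul_measure, MeasureTheory.lintegral_dirac' _ (measurable_from_top)]
  rfl

theorem law_apply (p : stdSimplex ℝ B) (s : Set B) :
    law p s = ∑ b, ENNReal.ofReal (p b) * s.indicator 1 b := by
  let _ : MeasurableSpace B := ⊤
  rw [← MeasureTheory.lintegral_indicator_one (μ := law p) (s := s) trivial, lintegral_law]

theorem isFiniteMeasure_law (p : stdSimplex ℝ B) : @MeasureTheory.IsFiniteMeasure B ⊤ (law p) := by
  let _ : MeasurableSpace B := ⊤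
  refine ⟨?_⟩
  rw [law_apply]
  exact ENNReal.sum_lt_top.2 fun b _ => by simp

theorem law_singleton (p : stdSimplex ℝ B) (b : B) : law p {b} = ENNReal.ofReal (p b) := by
  classical
  rw [law_apply, Finset.sum_eq_single b]
  · simp
  · intro c _ hc
    simp [hc]
  · simp

theorem law_absolutelyContinuous_iff (p q : stdSimplex ℝ B) :
    (@MeasureTheory.Measure.AbsolutelyContinuous B ⊤ (law p) (law q)) ↔
      ∀ b, q b = 0 → p b = 0 := by
  let _ : MeasurableSpace B := ⊤
  constructor
  · intro h b hb
    have := h (s := {b}) (by rw [law_singleton, hb, ENNReal.ofReal_zero])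
    rw [law_singleton, ENNReal.ofReal_eq_zero] at this
    exact le_antisymm this (stdSimplex.zero_le p b)
  · intro h s hs
    rw [law_apply, Finset.sum_eq_zero_iff] at hs ⊢
    intro b hb
    rcases mul_eq_zero.1 (hs b hb) with h0 | h0
    · rw [h b (le_antisymm (ENNReal.ofReal_eq_zero.1 h0) (stdSimplex.zero_le q b))]
      simp
    · rw [h0, mul_zero]

theorem relEntropy_of_not_ac {p q : stdSimplex ℝ B} (h : ¬ ∀ b, q b = 0 → p b = 0) :
    relEntropy p q = ⊤ :=
  let _ : MeasurableSpace B := ⊤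
  InformationTheory.klDiv_of_not_ac fun h' => h ((law_absolutelyContinuous_iff p q).1 h')

/-- The density of `law p` with respect to `law q` is `p / q`. The divergence integrates `u log u +
1 - u` at this ratio, and the correction `q - p` sums to zero. -/
theorem relEntropy_of_ac {p q : stdSimplex ℝ B} (h : ∀ b, q b = 0 → p b = 0) :
    relEntropy p q = ENNReal.ofReal (klSum p q) := by
  let _ : MeasurableSpace B := ⊤
  have := isFiniteMeasure_law p
  have := isFiniteMeasure_law q
  have hac := (law_absolutelyContinuous_iff p q).2 h
  have hd : law p = (law q).withDensity fun b => ENNReal.ofReal (p b / q b) := by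
    ext s hs
    rw [MeasureTheory.withDensity_apply _ hs, ← MeasureTheory.lintegral_indicator hs,
      lintegral_law, law_apply]
    refine Finset.sum_congr rfl fun b _ => ?_
    by_cases hb : b ∈ s
    · simp only [Set.indicator_of_mem hb, Pi.one_apply, mul_one]
      rw [← ENNReal.ofReal_mul (stdSimplex.zero_le q b)]
      by_cases h0 : q b = 0
      · simp [h0, h b h0]
      · rw [mul_div_cancel₀ _ h0]
    · simp [Set.indicator_of_notMem hb]
  have hrn : (law p).rnDeriv (law q) =ᵐ[law q] fun b => ENNReal.ofReal (p b / q b) := by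
    conv_lhs => rw [hd]
    exact MeasureTheory.Measure.rnDeriv_withDensity _ measurable_from_top
  unfold relEntropy
  rw [InformationTheory.klDiv_eq_lintegral_klFun_of_ac hac,
    MeasureTheory.lintegral_congr_ae (g := fun b => ENNReal.ofReal
      (InformationTheory.klFun (p b / q b)))
      (hrn.mono fun b hb => by
        simp only [hb, ENNReal.toReal_ofReal (div_nonneg (stdSimplex.zero_le p b) (stdSimplex.zero_le q b))]),
    lintegral_law]
  have h1 : ∀ b, 0 ≤ q b * InformationTheory.klFun (p b / q b) := fun b =>
    mul_nonneg (stdSimplex.zero_le q b) (InformationTheory.klFun_nonneg (div_nonneg (stdSimplex.zero_le p b) (stdSimplex.zero_le q b)))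
  rw [Finset.sum_congr rfl fun b _ => (ENNReal.ofReal_mul (stdSimplex.zero_le q b)).symm,
    ← ENNReal.ofReal_sum_of_nonneg fun b _ => h1 b]
  congr 1
  have h2 : ∀ b, q b * InformationTheory.klFun (p b / q b) =
      p b * (Real.log (p b) - Real.log (q b)) + (q b - p b) := by
    intro b
    by_cases h0 : q b = 0
    · simp [h0, h b h0]
    by_cases h0' : p b = 0
    · simp [h0', InformationTheory.klFun]
    rw [InformationTheory.klFun, Real.log_div h0' h0]
    field_simp
    ring
  rw [Finset.sum_congr rfl fun b _ => h2 b, Finset.sum_add_distrib, Finset.sum_sub_distrib]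
  have hp : ∑ b, p b = 1 := p.2.2
  have hq : ∑ b, q b = 1 := q.2.2
  rw [hp, hq, klSum]
  ring

theorem klSum_nonneg' {p q : stdSimplex ℝ B} (h : ∀ b, q b = 0 → p b = 0) : 0 ≤ klSum p q :=
  klSum_nonneg p.2.1 q.2.1 h (le_of_eq (q.2.2.trans p.2.2.symm))

theorem eq_of_klSum_nonpos {p q : stdSimplex ℝ B} (h : ∀ b, q b = 0 → p b = 0)
    (h0 : klSum p q ≤ 0) : p = q := by
  let _ : MeasurableSpace B := ⊤
  have := isFiniteMeasure_law p
  have := isFiniteMeasure_law q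
  have h1 : relEntropy p q = 0 := by rw [relEntropy_of_ac h, ENNReal.ofReal_eq_zero.2 h0]
  have h2 : law p = law q := InformationTheory.klDiv_eq_zero_iff.1 h1
  refine stdSimplex.ext (funext fun b => ?_)
  have h3 := congrArg (fun m => m {b}) h2
  simp only [law_singleton] at h3
  exact (ENNReal.ofReal_eq_ofReal_iff (stdSimplex.zero_le p b) (stdSimplex.zero_le q b)).1 h3

end Bridge

/-! ### Mutual information and the capacity-achieving output law -/

section Channel

variable {A B : Type*} [Fintype A] [Fintype B]

theorem joint_apply (S : stdSimplex ℝ A) (W : A → stdSimplex ℝ B) (ab : A × B) :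
    joint S W ab = S ab.1 * W ab.1 ab.2 := rfl

theorem output_apply (S : stdSimplex ℝ A) (W : A → stdSimplex ℝ B) (b : B) :
    output S W b = ∑ a, S a * W a b := rfl

theorem condRelEntropy_of_ac {W : A → stdSimplex ℝ B} {q : stdSimplex ℝ B} (S : stdSimplex ℝ A)
    (h : ∀ a b, q b = 0 → W a b = 0) :
    condRelEntropy W q S = ENNReal.ofReal (∑ a, S a * klSum (W a) q) := by
  rw [condRelEntropy, relEntropy_of_ac]
  · congr 1
    rw [klSum, Fintype.sum_prod_type]
    refine Finset.sum_congr rfl fun a _ => ?_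
    rw [klSum, Finset.mul_sum]
    refine Finset.sum_congr rfl fun b _ => ?_
    simp only [joint_apply]
    by_cases h1 : S a = 0
    · simp [h1]
    by_cases h2 : W a b = 0
    · simp [h2]
    have h3 : q b ≠ 0 := fun h' => h2 (h a b h')
    rw [Real.log_mul h1 h2, Real.log_mul h1 h3]
    ring
  · rintro ⟨a, b⟩ h1
    simp only [joint_apply] at h1 ⊢
    rcases mul_eq_zero.1 h1 with h1 | h1
    · rw [h1, zero_mul]
    · rw [h a b h1, mul_zero]

/-- The mutual information of input and output. -/
noncomputable def mutInfo (S : stdSimplex ℝ A) (W : A → stdSimplex ℝ B) : ℝ :=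
  ∑ a, S a * klSum (W a) (output S W)

/-- Insert the output law between `W a` and `q` in the difference of logarithms. The identity is
linear in these differences, so `q` may be any function. -/
theorem sum_klSum_eq (S : stdSimplex ℝ A) (W : A → stdSimplex ℝ B) (q : B → ℝ) :
    ∑ a, S a * klSum (W a) q = mutInfo S W + klSum (output S W) q := by
  have key : ∀ f : B → ℝ, ∑ a, S a * ∑ b, W a b * f b = ∑ b, output S W b * f b := by
    intro f
    simp only [Finset.mul_sum, output_apply, Finset.sum_mul]
    rw [Finset.sum_comm]
    exact Finset.sum_congr rfl fun b _ => Finset.sum_congr rfl fun a _ => by ring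
  rw [mutInfo, klSum]
  simp only [klSum, mul_sub, Finset.sum_sub_distrib]
  rw [key fun b => Real.log (q b), key fun b => Real.log (output S W b)]
  ring

theorem output_ac {S : stdSimplex ℝ A} {W : A → stdSimplex ℝ B} {a : A} (ha : S a ≠ 0) {b : B}
    (hb : output S W b = 0) : W a b = 0 := by
  rw [output_apply, Finset.sum_eq_zero_iff_of_nonneg
    fun a _ => mul_nonneg (stdSimplex.zero_le S a) (stdSimplex.zero_le (W a) b)] at hb
  exact (mul_eq_zero.1 (hb a (Finset.mem_univ a))).resolve_left ha

theorem mutInfo_nonneg (S : stdSimplex ℝ A) (W : A → stdSimplex ℝ B) : 0 ≤ mutInfo S W := by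
  refine Finset.sum_nonneg fun a _ => ?_
  by_cases ha : S a = 0
  · rw [ha, zero_mul]
  · exact mul_nonneg (stdSimplex.zero_le S a) (klSum_nonneg' fun b hb => output_ac ha hb)

/-- The reference `q = 1` gives output entropy plus a term linear in `S`, a form whose continuity is
clear up to the boundary of the simplex. -/
theorem mutInfo_eq (S : stdSimplex ℝ A) (W : A → stdSimplex ℝ B) :
    mutInfo S W = ∑ b, Real.negMulLog (output S W b) +
      ∑ a, S a * ∑ b, W a b * Real.log (W a b) := by
  have h := sum_klSum_eq S W (fun _ => 1)
  simp only [klSum, Real.log_one, sub_zero] at h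
  rw [h]
  simp [Real.negMulLog]

theorem continuous_mutInfo (W : A → stdSimplex ℝ B) : Continuous fun S => mutInfo S W := by
  have hc : ∀ a : A, Continuous fun S : stdSimplex ℝ A => S a := fun a =>
    (continuous_apply a).comp continuous_subtype_val
  simp only [mutInfo_eq, output_apply]
  refine Continuous.add ?_ ?_
  · exact continuous_finsetSum _ fun b _ => Real.continuous_negMulLog.comp
      (continuous_finsetSum _ fun a _ => (hc a).mul continuous_const)
  · exact continuous_finsetSum _ fun a _ => (hc a).mul continuous_const

/-- The input law `(1 - t) S + t δ_x`. -/
theorem exists_mix [DecidableEq A] (S : stdSimplex ℝ A) (x : A) {t : ℝ} (h0 : 0 ≤ t) (h1 : t ≤ 1) :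
    ∃ S' : stdSimplex ℝ A, ∀ a, S' a = (1 - t) * S a + t * (if a = x then 1 else 0) := by
  refine ⟨⟨fun a => (1 - t) * S a + t * (if a = x then 1 else 0), fun a => ?_, ?_⟩, fun a => rfl⟩
  · have h2 : 0 ≤ 1 - t := by linarith
    have : 0 ≤ S a := S.2.1 a
    dsimp only
    split_ifs <;> positivity
  · rw [Finset.sum_add_distrib, ← Finset.mul_sum, ← Finset.mul_sum]
    have : ∑ a, S a = 1 := S.2.2
    simp [this]

/-- Move mass `t` from the optimal `S` to `x`, with new output `Tt t`. The new mutual information is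
at least `(1 - t) I + t D(W x‖Tt t)`, so optimality gives `D(W x‖Tt t) ≤ I`. Then let `t → 0`. -/
theorem klSum_le_of_isMax {S : stdSimplex ℝ A} {W : A → stdSimplex ℝ B}
    (hS : ∀ S', mutInfo S' W ≤ mutInfo S W) (x : A) :
    (∀ b, output S W b = 0 → W x b = 0) ∧ klSum (W x) (output S W) ≤ mutInfo S W := by
  classical
  set I := mutInfo S W with hI
  set T : B → ℝ := fun b => output S W b with hT
  set Tt : ℝ → B → ℝ := fun t b => (1 - t) * T b + t * W x b with hTt
  have hT0 : ∀ b, 0 ≤ T b := fun b => (output S W).2.1 b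
  have hT1 : ∀ b, T b ≤ 1 := fun b => stdSimplex.le_one (output S W) b
  have hW0 : ∀ b, 0 ≤ W x b := fun b => (W x).2.1 b
  have hW1 : ∀ b, W x b ≤ 1 := fun b => stdSimplex.le_one (W x) b
  have key : ∀ t ∈ Set.Ioo (0 : ℝ) 1, klSum (W x) (Tt t) ≤ I := by
    intro t ht
    obtain ⟨S', hS'⟩ := exists_mix S x ht.1.le ht.2.le
    have hout : (output S' W : B → ℝ) = Tt t := by
      funext b
      simp only [output_apply, hS', hTt, hT, add_mul, Finset.sum_add_distrib, mul_assoc,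
        ← Finset.mul_sum]
      simp
    have h1 := hS S'
    have h2 : mutInfo S' W = (1 - t) * ∑ a, S a * klSum (W a) (Tt t) + t * klSum (W x) (Tt t) := by
      simp only [mutInfo, hout, hS', add_mul, Finset.sum_add_distrib, mul_assoc,
        ← Finset.mul_sum]
      simp
    rw [h2, sum_klSum_eq] at h1
    have h3 : 0 ≤ klSum (output S W) (Tt t) := by
      rw [← hout]
      refine klSum_nonneg' fun b hb => ?_
      rw [show output S' W b = Tt t b from congrFun hout b] at hb
      have h4 : 0 ≤ t * W x b := mul_nonneg ht.1.le (hW0 b)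
      have h5 : 0 ≤ (1 - t) * T b := mul_nonneg (by linarith [ht.2]) (hT0 b)
      have h6 : (1 - t) * T b = 0 := by
        have : (1 - t) * T b + t * W x b = 0 := hb
        linarith
      exact (mul_eq_zero.1 h6).resolve_left (by linarith [ht.2])
    have h4 : 0 ≤ (1 - t) * klSum (output S W) (Tt t) := mul_nonneg (by linarith [ht.2]) h3
    have h5 : t * klSum (W x) (Tt t) ≤ t * I := by rw [← hI] at h1; nlinarith
    exact le_of_mul_le_mul_left h5 ht.1
  have hTt1 : ∀ t ∈ Set.Ioo (0 : ℝ) 1, ∀ b, 0 ≤ Tt t b ∧ Tt t b ≤ 1 := by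
    intro t ht b
    have := hT0 b; have := hT1 b; have := hW0 b; have := hW1 b
    have h1 := ht.1; have h2 : 0 < 1 - t := by linarith [ht.2]
    refine ⟨by positivity, ?_⟩
    simp only [hTt]
    nlinarith
  have hmem : ∀ᶠ t in 𝓝[>] (0 : ℝ), t ∈ Set.Ioo (0 : ℝ) 1 := Ioo_mem_nhdsGT one_pos
  -- If `T b = 0 < W x b`, then `Tt t b = t * W x b`, and the divergence just bounded by `I` would
  -- blow up as `t → 0`.
  have hac : ∀ b, T b = 0 → W x b = 0 := by
    intro b hb
    by_contra hw
    have hw : 0 < W x b := (hW0 b).lt_of_ne' hw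
    have hlim : Tendsto (fun t : ℝ => W x b * -Real.log (t * W x b)) (𝓝[>] 0) atTop := by
      refine Tendsto.const_mul_atTop hw (tendsto_neg_atBot_atTop.comp
        (Real.tendsto_log_nhdsGT_zero.comp (tendsto_nhdsWithin_iff.2 ⟨?_, ?_⟩)))
      · have : Tendsto (fun t : ℝ => t * W x b) (𝓝 0) (𝓝 (0 * W x b)) :=
          (continuous_id.mul continuous_const).tendsto 0
        rw [zero_mul] at this
        exact this.mono_left nhdsWithin_le_nhds
      · filter_upwards [self_mem_nhdsWithin] with t ht
        exact mul_pos ht hw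
    obtain ⟨t, ht, hbig⟩ := (hmem.and (hlim.eventually_gt_atTop
      (I - ∑ b, W x b * Real.log (W x b)))).exists
    have h1 := key t ht
    have h2 : klSum (W x) (Tt t) = ∑ b, W x b * Real.log (W x b) +
        ∑ b, W x b * -Real.log (Tt t b) := by
      rw [klSum, ← Finset.sum_add_distrib]
      exact Finset.sum_congr rfl fun b _ => by ring
    have h3 : W x b * -Real.log (Tt t b) ≤ ∑ b, W x b * -Real.log (Tt t b) :=
      Finset.single_le_sum (f := fun b => W x b * -Real.log (Tt t b))
        (fun b _ => mul_nonneg (hW0 b)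
        (neg_nonneg.2 (Real.log_nonpos (hTt1 t ht b).1 (hTt1 t ht b).2))) (Finset.mem_univ b)
    have h4 : Tt t b = t * W x b := by simp [hTt, hb]
    rw [h4] at h3
    linarith
  refine ⟨hac, ?_⟩
  have hlim : Tendsto (fun t : ℝ => klSum (W x) (Tt t)) (𝓝[>] 0) (𝓝 (klSum (W x) T)) := by
    refine tendsto_finsetSum _ fun b _ => ?_
    by_cases hw : W x b = 0
    · simp [hw]
    have hTb : T b ≠ 0 := fun h => hw (hac b h)
    have h1 : Tendsto (fun t : ℝ => Tt t b) (𝓝 0) (𝓝 (Tt 0 b)) := by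
      have : Continuous fun t : ℝ => Tt t b := by simp only [hTt]; fun_prop
      exact this.tendsto 0
    have h2 : Tt 0 b = T b := by simp [hTt]
    rw [h2] at h1
    exact (((h1.mono_left nhdsWithin_le_nhds).log hTb).const_sub _).const_mul _
  exact le_of_tendsto hlim (hmem.mono key)

theorem exists_isMax_mutInfo [Nonempty A] (W : A → stdSimplex ℝ B) :
    ∃ S, ∀ S', mutInfo S' W ≤ mutInfo S W := by
  obtain ⟨S, -, hS⟩ := isCompact_univ.exists_isMaxOn Set.univ_nonempty
    (continuous_mutInfo W).continuousOn
  exact ⟨S, fun S' => hS (Set.mem_univ S')⟩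

/-- A capacity-achieving output distribution is the output of an optimal input law. -/
theorem IsCapacityAchievingOutput.exists_input [Nonempty A] {W : A → stdSimplex ℝ B}
    {Q : stdSimplex ℝ B} (hQ : IsCapacityAchievingOutput W Q) :
    ∃ S, output S W = Q ∧ ∀ x, (∀ b, Q b = 0 → W x b = 0) ∧ klSum (W x) Q ≤ mutInfo S W := by
  classical
  obtain ⟨S, hS⟩ := exists_isMax_mutInfo W
  have hk := klSum_le_of_isMax hS
  suffices h : output S W = Q by
    refine ⟨S, h, fun x => ?_⟩
    rw [← h]
    exact hk x
  -- The output of the optimal `S` has worst-case divergence at most `I(S)`, and `Q` does at least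
  -- as well.
  have hle : ⨆ S', condRelEntropy W Q S' ≤ ENNReal.ofReal (mutInfo S W) := by
    refine (hQ (output S W)).trans (iSup_le fun S' => ?_)
    rw [condRelEntropy_of_ac S' fun a => (hk a).1]
    refine ENNReal.ofReal_le_ofReal ?_
    calc ∑ a, S' a * klSum (W a) (output S W) ≤ ∑ a, S' a * mutInfo S W :=
          Finset.sum_le_sum fun a _ => mul_le_mul_of_nonneg_left (hk a).2 (stdSimplex.zero_le S' a)
      _ = mutInfo S W := by
          rw [← Finset.sum_mul]
          exact (congrArg (· * mutInfo S W) S'.2.2).trans (one_mul _)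
  have hle' : ∀ S', condRelEntropy W Q S' ≤ ENNReal.ofReal (mutInfo S W) := fun S' =>
    (le_iSup _ S').trans hle
  have hac : ∀ a b, Q b = 0 → W a b = 0 := by
    intro a b hb
    by_contra hw
    refine absurd (hle' (stdSimplex.vertex a)) (not_le.2 ?_)
    rw [condRelEntropy, relEntropy_of_not_ac]
    · exact ENNReal.ofReal_lt_top
    · intro h
      have := h (a, b) (by simp [joint_apply, hb])
      simp [joint_apply, hw] at this
  -- Evaluated at `S` itself, the bound reads `I(S) + D(output‖Q) ≤ I(S)`.
  have h1 := hle' S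
  rw [condRelEntropy_of_ac S hac, ENNReal.ofReal_le_ofReal_iff (mutInfo_nonneg S W),
    sum_klSum_eq] at h1
  refine eq_of_klSum_nonpos (fun b hb => ?_) (by linarith)
  rw [output_apply]
  exact Finset.sum_eq_zero fun a _ => by rw [hac a b hb, mul_zero]

end Channel

/-! ### Sums over blocks -/

section Product

variable {A B : Type*} [Fintype B] {n : ℕ}

theorem sum_prod_eq_prod_sum (f : Fin n → B → ℝ) :
    ∑ x : Fin n → B, ∏ i, f i (x i) = ∏ i, ∑ b, f i b := by
  classical
  rw [Finset.prod_univ_sum, Fintype.piFinset_univ]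

theorem blockProb_nonneg (W : A → stdSimplex ℝ B) (x : Fin n → A) (y : Fin n → B) :
    0 ≤ blockProb W x y :=
  Finset.prod_nonneg fun i _ => stdSimplex.zero_le (W (x i)) (y i)

theorem sum_blockProb (W : A → stdSimplex ℝ B) (x : Fin n → A) : ∑ y, blockProb W x y = 1 := by
  simp only [blockProb]
  rw [sum_prod_eq_prod_sum fun i b => W (x i) b]
  exact Finset.prod_eq_one fun i _ => stdSimplex.sum_eq_one _

end Product

section Blocks

variable {A B : Type*} [Fintype A] [Fintype B] {n : ℕ}

theorem sum_cons (g : (Fin (n + 1) → A) → ℝ) :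
    ∑ v, g v = ∑ a, ∑ v : Fin n → A, g (Fin.cons a v : Fin (n + 1) → A) := by
  rw [← Fintype.sum_prod_type' fun a (v : Fin n → A) => g (Fin.cons a v : Fin (n + 1) → A)]
  exact (Fintype.sum_equiv (Fin.consEquiv fun _ => A) _ _ fun _ => rfl).symm

theorem sum_sum_eq_sum_pair (g : (Fin n → A) → (Fin n → B) → ℝ) :
    ∑ x, ∑ y, g x y = ∑ c : Fin n → A × B, g (fun i => (c i).1) (fun i => (c i).2) := by
  rw [← Fintype.sum_prod_type' g]
  exact (Fintype.sum_equiv (Equiv.arrowProdEquivProdArrow (Fin n) (fun _ => A) fun _ => B)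
    _ _ fun _ => rfl).symm

theorem sum_prod_eq_one {p : A → ℝ} (hp : ∑ a, p a = 1) :
    ∑ x : Fin n → A, ∏ i, p (x i) = 1 := by
  rw [sum_prod_eq_prod_sum fun _ => p]
  simp [hp]

/-- The second moment of a sum of independent centred terms. -/
theorem sum_prod_mul_sum_sq {p f : A → ℝ} (hp : ∑ a, p a = 1) (hf : ∑ a, p a * f a = 0) :
    ∑ x : Fin n → A, (∏ i, p (x i)) * (∑ i, f (x i)) ^ 2 = n * ∑ a, p a * f a ^ 2 := by
  induction n with
  | zero => simp
  | succ n ih =>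
    rw [sum_cons]
    simp only [Fin.prod_univ_succ, Fin.sum_univ_succ, Fin.cons_zero, Fin.cons_succ]
    have : ∀ a (v : Fin n → A), p a * (∏ i, p (v i)) * (f a + ∑ i, f (v i)) ^ 2 =
        p a * f a ^ 2 * (∏ i, p (v i)) + p a * f a * (2 * ((∏ i, p (v i)) * ∑ i, f (v i))) +
        p a * ((∏ i, p (v i)) * (∑ i, f (v i)) ^ 2) := by
      intros; ring
    simp only [this, Finset.sum_add_distrib, ← Finset.mul_sum, ih, ← Finset.sum_mul, hf, hp,
      sum_prod_eq_one hp]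
    push_cast
    ring

end Blocks

/-! ### Feinstein's lemma -/

section Feinstein

variable {α β : Type*} [Fintype α] [Fintype β]

open Classical in
/-- Feinstein's lemma. -/
theorem exists_code_of_threshold {p : α → ℝ} (hp0 : ∀ a, 0 ≤ p a) (hp1 : ∑ a, p a = 1)
    {w : α → β → ℝ} (hw0 : ∀ a b, 0 ≤ w a b) (hw1 : ∀ a, ∑ b, w a b = 1) {t : β → ℝ}
    (ht : ∀ b, t b = ∑ a, p a * w a b) {γ : ℝ} (hγ : 0 < γ) {M : ℕ} (hM : 0 < M) {r : ℝ}
    (h : ∑ a, p a * ∑ b, w a b * (if γ * t b < w a b then 0 else 1) + M / γ < r) :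
    ∃ (f : Fin M → α) (φ : β → Fin M),
      ∀ i, ∑ b, w (f i) b * (if φ b = i then 0 else 1) ≤ r := by
  -- Greedy construction: word `i` decodes the outputs that pass its threshold and none of the
  -- earlier ones. Indexing by `ℕ` lets a word be added with `Function.update`.
  have hex : ∀ k ≤ M, ∃ f : ℕ → α, ∀ i < k, 1 - r ≤ ∑ b, w (f i) b *
      (if γ * t b < w (f i) b ∧ ∀ j < i, ¬ γ * t b < w (f j) b then 1 else 0) := by
    intro k
    induction k with
    | zero =>
      intro _
      have : Nonempty α := by
        by_contra hα
        rw [not_nonempty_iff] at hα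
        simp at hp1
      exact ⟨fun _ => Classical.arbitrary α, fun i hi => absurd hi (Nat.not_lt_zero i)⟩
    | succ k ih =>
      intro hk
      obtain ⟨f, hf⟩ := ih (by omega)
      obtain ⟨a, ha⟩ : ∃ a, 1 - r ≤ ∑ b, w a b *
          (if γ * t b < w a b ∧ ∀ j < k, ¬ γ * t b < w (f j) b then 1 else 0) := by
        -- If no word could be added, averaging over `p` would contradict `h`: the earlier regions
        -- cover too little.
        by_contra hcon
        replace hcon := fun a => not_le.1 (not_exists.1 hcon a)
        have h1 : ∀ a, 1 - (∑ b, w a b * (if γ * t b < w a b then 0 else 1)) -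
            ∑ b, w a b * ∑ j ∈ Finset.range k, (if γ * t b < w (f j) b then 1 else 0) ≤
            1 - r := by
          intro a
          refine le_trans ?_ (hcon a).le
          rw [← congrArg₂ (· - ·) (congrArg₂ (· - ·) (hw1 a) rfl) rfl]
          simp only [← Finset.sum_sub_distrib]
          refine Finset.sum_le_sum fun b _ => ?_
          rw [show ∀ u v z : ℝ, u - u * v - u * z = u * (1 - v - z) by intros; ring]
          refine mul_le_mul_of_nonneg_left ?_ (hw0 a b)
          have hs : ∀ j ∈ Finset.range k, (0 : ℝ) ≤ if γ * t b < w (f j) b then 1 else 0 :=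
            fun j _ => by split_ifs <;> norm_num
          have hs0 := Finset.sum_nonneg hs
          by_cases hA : γ * t b < w a b
          · by_cases hB : ∀ j < k, ¬ γ * t b < w (f j) b
            · rw [if_pos hA, if_pos ⟨hA, hB⟩]
              linarith
            · rw [if_pos hA, if_neg fun h => hB h.2]
              push Not at hB
              obtain ⟨j, hj, hjb⟩ := hB
              have := Finset.single_le_sum hs (Finset.mem_range.2 hj)
              rw [if_pos hjb] at this
              linarith
          · rw [if_neg hA, if_neg fun h => hA h.1]
            linarith
        have h2 : ∑ a, p a * (1 - (∑ b, w a b * (if γ * t b < w a b then 0 else 1)) -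
            ∑ b, w a b * ∑ j ∈ Finset.range k, (if γ * t b < w (f j) b then 1 else 0)) ≤
            1 - r := by
          calc _ ≤ ∑ a, p a * (1 - r) :=
                Finset.sum_le_sum fun a _ => mul_le_mul_of_nonneg_left (h1 a) (hp0 a)
            _ = 1 - r := by rw [← Finset.sum_mul, hp1, one_mul]
        simp only [mul_sub, Finset.sum_sub_distrib, mul_one, hp1] at h2
        -- Averaging `w` over `p` gives `t`. Each earlier region has `t`-mass at most `1 / γ`, since
        -- `t < w / γ` there.
        have h3 : ∑ a, p a * ∑ b, w a b *
            ∑ j ∈ Finset.range k, (if γ * t b < w (f j) b then (1 : ℝ) else 0) ≤ M / γ := by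
          have h4 : ∑ a, p a * ∑ b, w a b *
              ∑ j ∈ Finset.range k, (if γ * t b < w (f j) b then (1 : ℝ) else 0) =
              ∑ j ∈ Finset.range k, ∑ b, t b * (if γ * t b < w (f j) b then (1 : ℝ) else 0) := by
            simp only [Finset.mul_sum]
            rw [Finset.sum_comm' (t' := Finset.univ) (s' := fun _ => Finset.univ) (by simp)]
            rw [Finset.sum_comm' (s := Finset.range k) (t' := Finset.univ)
              (s' := fun _ => Finset.range k) (by simp)]
            refine Finset.sum_congr rfl fun b _ => ?_
            rw [Finset.sum_comm]
            refine Finset.sum_congr rfl fun j _ => ?_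
            simp only [ht b, Finset.sum_mul]
            exact Finset.sum_congr rfl fun a _ => by ring
          rw [h4]
          calc _ ≤ ∑ j ∈ Finset.range k, 1 / γ := by
                refine Finset.sum_le_sum fun j _ => ?_
                calc _ ≤ ∑ b, w (f j) b / γ := by
                      refine Finset.sum_le_sum fun b _ => ?_
                      split_ifs with hb
                      · rw [mul_one, le_div_iff₀ hγ, mul_comm]
                        exact hb.le
                      · rw [mul_zero]
                        exact div_nonneg (hw0 _ _) hγ.le
                  _ = 1 / γ := by rw [← Finset.sum_div, hw1]
            _ = k / γ := by rw [Finset.sum_const, Finset.card_range, nsmul_eq_mul, mul_one_div]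
            _ ≤ M / γ := by
                have : (k : ℝ) ≤ M := by exact_mod_cast (by omega : k ≤ M)
                gcongr
        linarith
      refine ⟨Function.update f k a, fun i hi => ?_⟩
      rcases Nat.lt_succ_iff_lt_or_eq.1 hi with hi | rfl
      · convert hf i hi using 4 with b
        · rw [Function.update_of_ne hi.ne]
        · have : (∀ j < i, ¬ γ * t b < w (Function.update f k a j) b) ↔
              ∀ j < i, ¬ γ * t b < w (f j) b :=
            forall₂_congr fun j hj => by rw [Function.update_of_ne (hj.trans hi).ne]
          rw [this, Function.update_of_ne hi.ne]
      · convert ha using 4 with b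
        · rw [Function.update_self]
        · have : (∀ j < i, ¬ γ * t b < w (Function.update f i a j) b) ↔
              ∀ j < i, ¬ γ * t b < w (f j) b :=
            forall₂_congr fun j hj => by rw [Function.update_of_ne hj.ne]
          rw [this, Function.update_self]
  obtain ⟨f, hf⟩ := hex M le_rfl
  -- The decoder takes the first index whose threshold is passed; the fallback `0` is arbitrary.
  refine ⟨fun i => f i, fun b => if hb : ∃ i, i < M ∧ γ * t b < w (f i) b then
    ⟨Nat.find hb, (Nat.find_spec hb).1⟩ else ⟨0, hM⟩, fun i => ?_⟩
  have h1 := hf i i.2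
  suffices h2 : ∑ b, w (f i) b * (if (if hb : ∃ i, i < M ∧ γ * t b < w (f i) b then
      (⟨Nat.find hb, (Nat.find_spec hb).1⟩ : Fin M) else ⟨0, hM⟩) = i then (0 : ℝ) else 1) ≤
      ∑ b, (w (f i) b - w (f i) b * (if γ * t b < w (f i) b ∧
        ∀ j < (i : ℕ), ¬ γ * t b < w (f j) b then 1 else 0)) by
    rw [Finset.sum_sub_distrib, hw1] at h2
    linarith
  refine Finset.sum_le_sum fun b _ => ?_
  by_cases hD : γ * t b < w (f i) b ∧ ∀ j < (i : ℕ), ¬ γ * t b < w (f j) b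
  · have hb : ∃ i, i < M ∧ γ * t b < w (f i) b := ⟨i, i.2, hD.1⟩
    have hfind : Nat.find hb = i :=
      (Nat.find_eq_iff hb).2 ⟨⟨i.2, hD.1⟩, fun j hj hj' => hD.2 j hj hj'.2⟩
    rw [dif_pos hb, if_pos (Fin.ext hfind), if_pos hD]
    simp
  · rw [if_neg hD, mul_zero, sub_zero]
    refine mul_le_of_le_one_right (hw0 _ _) ?_
    split_ifs <;> norm_num

end Feinstein

theorem numMsg_pos {n : ℕ} {R : ℝ} (hR : 0 ≤ R) : 0 < numMsg n R :=
  Nat.floor_pos.2 (Real.one_le_exp (by positivity))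

theorem numMsg_le (n : ℕ) (R : ℝ) : (numMsg n R : ℝ) ≤ Real.exp (n * R) :=
  Nat.floor_le (Real.exp_pos _).le

/-! ### Rates below the mutual information -/

section Achievability

variable {A B : Type*} [Fintype A] [Fintype B]

open Classical in
-- Chebyshev's inequality: the information density of the block has mean `n I`, and missing the
-- threshold means falling at least `n δ` below it.
theorem sum_threshold_le (S : stdSimplex ℝ A) (W : A → stdSimplex ℝ B) {n : ℕ} (hn : 0 < n)
    {δ : ℝ} (hδ : 0 < δ) :
    ∑ x : Fin n → A, (∏ i, S (x i)) * ∑ y : Fin n → B, blockProb W x y *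
      (if Real.exp (n * (mutInfo S W - δ)) * ∏ i, output S W (y i) < blockProb W x y
        then 0 else 1) ≤
    (∑ c : A × B, joint S W c * (Real.log (W c.1 c.2) - Real.log (output S W c.2) -
      mutInfo S W) ^ 2) / δ ^ 2 / n := by
  set I := mutInfo S W with hI
  set f : A × B → ℝ := fun c => Real.log (W c.1 c.2) - Real.log (output S W c.2) - I with hf
  have hjoint : ∑ c, joint S W c = 1 := stdSimplex.sum_eq_one _
  have hmean : ∑ c, joint S W c * f c = 0 := by
    have : ∀ c, joint S W c * f c = joint S W c *
        (Real.log (W c.1 c.2) - Real.log (output S W c.2)) - joint S W c * I := by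
      intro c
      rw [hf]
      ring
    rw [Finset.sum_congr rfl fun c _ => this c, Finset.sum_sub_distrib, ← Finset.sum_mul, hjoint,
      one_mul, sub_eq_zero, hI, mutInfo, Fintype.sum_prod_type]
    refine Finset.sum_congr rfl fun a _ => ?_
    rw [klSum, Finset.mul_sum]
    exact Finset.sum_congr rfl fun b _ => by rw [joint_apply]; ring
  have hnR : (0 : ℝ) < n := Nat.cast_pos.2 hn
  have hsq := sum_prod_mul_sum_sq (n := n) hjoint hmean
  simp only [Finset.mul_sum]
  rw [sum_sum_eq_sum_pair]
  have hterm : ∀ c : Fin n → A × B, (∏ i, S (c i).1) * (blockProb W (fun i => (c i).1)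
      (fun i => (c i).2) * (if Real.exp (n * (I - δ)) * ∏ i, output S W (c i).2 <
        blockProb W (fun i => (c i).1) (fun i => (c i).2) then 0 else 1)) ≤
      (∏ i, joint S W (c i)) * (∑ i, f (c i)) ^ 2 / (n * δ) ^ 2 := by
    intro c
    have hprod : ∏ i, joint S W (c i) =
        (∏ i, S (c i).1) * blockProb W (fun i => (c i).1) (fun i => (c i).2) := by
      rw [blockProb, ← Finset.prod_mul_distrib]
      rfl
    rw [← mul_assoc, ← hprod, mul_div_assoc]
    have h0 : 0 ≤ ∏ i, joint S W (c i) :=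
      Finset.prod_nonneg fun i _ => stdSimplex.zero_le _ _
    rcases h0.eq_or_lt with h0 | h0
    · rw [← h0, zero_mul, zero_mul]
    refine mul_le_mul_of_nonneg_left ?_ h0.le
    split_ifs with hA
    · positivity
    · push Not at hA
      have hpos : ∀ i, S (c i).1 ≠ 0 ∧ W (c i).1 (c i).2 ≠ 0 := by
        intro i
        have := Finset.prod_ne_zero_iff.1 h0.ne' i (Finset.mem_univ i)
        rw [joint_apply] at this
        exact ⟨left_ne_zero_of_mul this, right_ne_zero_of_mul this⟩
      have hout : ∀ i, output S W (c i).2 ≠ 0 := fun i h =>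
        (hpos i).2 (output_ac (hpos i).1 h)
      have hW : 0 < blockProb W (fun i => (c i).1) (fun i => (c i).2) :=
        (blockProb_nonneg _ _ _).lt_of_ne' (Finset.prod_ne_zero_iff.2 fun i _ => (hpos i).2)
      have hlog := Real.log_le_log hW hA
      rw [Real.log_mul (Real.exp_pos _).ne' (Finset.prod_ne_zero_iff.2 fun i _ => hout i),
        Real.log_exp, blockProb, Real.log_prod fun i _ => (hpos i).2,
        Real.log_prod fun i _ => hout i] at hlog
      have hsum : ∑ i, f (c i) = ∑ i, Real.log (W (c i).1 (c i).2) -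
          ∑ i, Real.log (output S W (c i).2) - n * I := by
        simp [hf, Finset.sum_sub_distrib]
      have hle : n * δ ≤ -∑ i, f (c i) := by
        rw [hsum]
        linarith
      rw [one_le_div (by positivity), ← neg_sq (∑ i, f (c i))]
      exact pow_le_pow_left₀ (by positivity) hle 2
  refine (Finset.sum_le_sum fun c _ => hterm c).trans (le_of_eq ?_)
  rw [← Finset.sum_div, hsq]
  field_simp
  rfl

/-- Every rate below the mutual information is achievable. -/
theorem eventually_exists_code (S : stdSimplex ℝ A) (W : A → stdSimplex ℝ B) {R : ℝ} (hR : 0 ≤ R)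
    (hRI : R < mutInfo S W) {r : ℝ} (hr : 0 < r) :
    ∀ᶠ n : ℕ in atTop, ∃ (f : Fin (numMsg n R) → Fin n → A)
      (φ : (Fin n → B) → Fin (numMsg n R)),
      ∀ i, ∑ y, blockProb W (f i) y * (if φ y = i then 0 else 1) ≤ r := by
  classical
  set I := mutInfo S W with hI
  -- With this `δ`, `I - δ = R + δ`, so the term `M / γ` of Feinstein's lemma is at most `exp (-n
  -- δ)`.
  obtain ⟨δ, hδ⟩ : ∃ δ, δ = (I - R) / 2 := ⟨_, rfl⟩
  have hδ0 : 0 < δ := by linarith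
  set V := ∑ c : A × B, joint S W c * (Real.log (W c.1 c.2) - Real.log (output S W c.2) -
      I) ^ 2
  have h1 : Tendsto (fun n : ℕ => V / δ ^ 2 / (n : ℝ)) atTop (𝓝 0) :=
    tendsto_const_nhds.div_atTop tendsto_natCast_atTop_atTop
  have h2 : Tendsto (fun n : ℕ => Real.exp (-(n * δ))) atTop (𝓝 0) :=
    Real.tendsto_exp_neg_atTop_nhds_zero.comp
      (tendsto_natCast_atTop_atTop.atTop_mul_const hδ0)
  have h3 := h1.add h2
  rw [add_zero] at h3
  filter_upwards [h3.eventually_lt_const hr, eventually_gt_atTop 0] with n hn hn0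
  refine exists_code_of_threshold (p := fun x : Fin n → A => ∏ i, S (x i))
    (t := fun y => ∏ i, output S W (y i)) (γ := Real.exp (n * (I - δ)))
    (fun x => Finset.prod_nonneg fun i _ => stdSimplex.zero_le _ _)
    (sum_prod_eq_one (stdSimplex.sum_eq_one S)) (blockProb_nonneg W) (sum_blockProb W)
    (fun y => ?_) (Real.exp_pos _) (numMsg_pos hR) (lt_of_le_of_lt (add_le_add
      (sum_threshold_le S W hn0 hδ0) ?_) hn)
  · simp only [output_apply, blockProb]
    rw [← sum_prod_eq_prod_sum fun i a => S a * W a (y i)]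
    exact Finset.sum_congr rfl fun x _ => Finset.prod_mul_distrib
  · rw [div_le_iff₀ (Real.exp_pos _), ← Real.exp_add]
    refine (numMsg_le n R).trans (Real.exp_le_exp.2 (le_of_eq ?_))
    rw [hδ]
    ring

end Achievability

/-! ### The operational capacity with unlimited relay rate -/

section Capacity

variable {X Y Z : Type*} [Fintype Y] [Fintype Z] {n : ℕ}

theorem sum_sum_blockProb_mul (PY : X → stdSimplex ℝ Y) (PZ : X → stdSimplex ℝ Z)
    (x : Fin n → X) (g : (Fin n → Y) → (Fin n → Z) → ℝ) :
    ∑ y, ∑ z, blockProb PY x y * blockProb PZ x z * g y z =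
      ∑ b, blockProb (prodChannel PY PZ) x b * g (fun i => (b i).1) (fun i => (b i).2) := by
  rw [sum_sum_eq_sum_pair]
  refine Finset.sum_congr rfl fun b _ => ?_
  simp only [blockProb]
  rw [← Finset.prod_mul_distrib]
  rfl

theorem errorOf_eq_sum (PY : X → stdSimplex ℝ Y) (PZ : X → stdSimplex ℝ Z) {M : ℕ}
    (enc : Fin M → (Fin n → X)) (est : (Fin n → Y) → (Fin n → Z) → Fin M) :
    errorOf PY PZ enc (fun _ => est) = (M : ℝ)⁻¹ * ∑ w, ∑ b, blockProb (prodChannel PY PZ) (enc w) b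
      * (if est (fun i => (b i).1) (fun i => (b i).2) = w then 0 else 1) := by
  unfold errorOf
  congr 1
  exact Finset.sum_congr rfl fun w _ => sum_sum_blockProb_mul PY PZ (enc w)
    fun y z => if est y z = w then 0 else 1

theorem errorOf_nonneg (PY : X → stdSimplex ℝ Y) (PZ : X → stdSimplex ℝ Z) {M : ℕ}
    (enc : Fin M → (Fin n → X)) (est : (Fin n → X) → (Fin n → Y) → (Fin n → Z) → Fin M) :
    0 ≤ errorOf PY PZ enc est := by
  refine mul_nonneg (by positivity) (Finset.sum_nonneg fun w _ => Finset.sum_nonneg fun y _ =>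
    Finset.sum_nonneg fun z _ => mul_nonneg
      (mul_nonneg (blockProb_nonneg _ _ _) (blockProb_nonneg _ _ _)) ?_)
  split_ifs <;> norm_num

theorem inv_mul_sum_le {M : ℕ} (hM : 0 < M) {f : Fin M → ℝ} {r : ℝ} (h : ∀ w, f w ≤ r) :
    (M : ℝ)⁻¹ * ∑ w, f w ≤ r := by
  have : ∑ w, f w ≤ M * r := (Finset.sum_le_sum fun w _ => h w).trans (by simp)
  rw [inv_mul_le_iff₀ (by positivity)]
  exact this

theorem errorOf_le_one (PY : X → stdSimplex ℝ Y) (PZ : X → stdSimplex ℝ Z) {M : ℕ} (hM : 0 < M)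
    (enc : Fin M → (Fin n → X)) (est : (Fin n → Y) → (Fin n → Z) → Fin M) :
    errorOf PY PZ enc (fun _ => est) ≤ 1 := by
  rw [errorOf_eq_sum]
  refine inv_mul_sum_le hM fun w => ?_
  refine (Finset.sum_le_sum fun b _ => mul_le_of_le_one_right (blockProb_nonneg _ _ _) ?_).trans
    (sum_blockProb (prodChannel PY PZ) (enc w)).le
  split_ifs <;> norm_num

theorem blockProb_le_one (W : X → stdSimplex ℝ Y) (x : Fin n → X) (y : Fin n → Y) :
    blockProb W x y ≤ 1 :=
  Finset.prod_le_one (fun _ _ => stdSimplex.zero_le _ _) fun _ _ => stdSimplex.le_one _ _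

/-- A block code with `M` messages is correct with probability at most `|𝒴 × 𝒵|ⁿ / M`. -/
theorem one_sub_errorOf_mul_le (PY : X → stdSimplex ℝ Y) (PZ : X → stdSimplex ℝ Z) {M : ℕ}
    (hM : 0 < M) (enc : Fin M → (Fin n → X)) (est : (Fin n → Y) → (Fin n → Z) → Fin M) :
    (1 - errorOf PY PZ enc fun _ => est) * M ≤ (Fintype.card (Y × Z) : ℝ) ^ n := by
  set φ : (Fin n → Y × Z) → Fin M := fun b => est (fun i => (b i).1) fun i => (b i).2
  have h1 : ∑ w, ∑ b, blockProb (prodChannel PY PZ) (enc w) b = (M : ℝ) := by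
    simp [sum_blockProb]
  have h2 : ∑ w, ∑ b, blockProb (prodChannel PY PZ) (enc w) b -
      ∑ w, ∑ b, blockProb (prodChannel PY PZ) (enc w) b * (if φ b = w then (0 : ℝ) else 1) ≤
      ∑ w, ∑ b : Fin n → Y × Z, if φ b = w then (1 : ℝ) else 0 := by
    simp only [← Finset.sum_sub_distrib]
    refine Finset.sum_le_sum fun w _ => Finset.sum_le_sum fun b _ => ?_
    have := blockProb_le_one (prodChannel PY PZ) (enc w) b
    split_ifs <;> linarith
  have h3 : ∑ w, ∑ b : Fin n → Y × Z, (if φ b = w then (1 : ℝ) else 0) =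
      (Fintype.card (Y × Z) : ℝ) ^ n := by
    rw [Finset.sum_comm]
    simp
  have hM' : (M : ℝ) ≠ 0 := by positivity
  rw [h3, h1] at h2
  rw [errorOf_eq_sum, sub_mul, one_mul, mul_comm (_ * _) (M : ℝ), mul_inv_cancel_left₀ hM']
  exact h2

/-- With messages in `ℕ` the relay can send its whole block through an injection, so the decoder
sees both outputs. -/
theorem exists_model1Code_top (PY : X → stdSimplex ℝ Y) (PZ : X → stdSimplex ℝ Z) {R : ℝ}
    (hR : 0 ≤ R) (enc : Fin (numMsg n R) → Fin n → X)
    (φ : (Fin n → Y × Z) → Fin (numMsg n R)) :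
    ∃ c : Model1Code X Y Z n R ⊤, c.errorProb PY PZ = (numMsg n R : ℝ)⁻¹ * ∑ w, ∑ b,
      blockProb (prodChannel PY PZ) (enc w) b * (if φ b = w then 0 else 1) := by
  classical
  obtain ⟨g, hg⟩ := exists_injective_nat (Fin n → Z)
  let c : Model1Code X Y Z n R ⊤ :=
    { enc := enc
      relay := fun z => (g z : ℕ)
      dec := fun (v : ℕ) y => if h : ∃ z, g z = v then φ fun i => (y i, h.choose i)
        else ⟨0, numMsg_pos hR⟩ }
  refine ⟨c, ?_⟩
  rw [Model1Code.errorProb, errorOf_eq_sum]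
  have : ∀ y z, c.dec (c.relay z) y = φ fun i => (y i, z i) := by
    intro y z
    have h : ∃ z', g z' = g z := ⟨z, rfl⟩
    have h' : h.choose = z := hg h.choose_spec
    change (if h : ∃ z', g z' = g z then _ else _) = _
    rw [dif_pos h, h']
  simp only [this]
  rfl

theorem two_mul_numMsg_ge {n : ℕ} {R : ℝ} (hR : 0 ≤ R) :
    Real.exp (n * R) ≤ 2 * numMsg n R := by
  have h1 : Real.exp (n * R) < numMsg n R + 1 := Nat.lt_floor_add_one _
  have h2 : (1 : ℝ) ≤ numMsg n R := Nat.one_le_cast.2 (numMsg_pos hR)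
  linarith

theorem nonempty_model1Code_top {X Y Z : Type*} [Nonempty X] (n : ℕ) {R : ℝ} (hR : 0 ≤ R) :
    Nonempty (Model1Code X Y Z n R ⊤) :=
  ⟨⟨fun _ _ => Classical.arbitrary X, fun _ => (0 : ℕ), fun _ _ => ⟨0, numMsg_pos hR⟩⟩⟩

variable (PY : X → stdSimplex ℝ Y) (PZ : X → stdSimplex ℝ Z)

theorem bddBelow_errorProb (n : ℕ) (R : ℝ) (R₀ : WithTop ℝ) :
    BddBelow (Set.range fun c : Model1Code X Y Z n R R₀ => c.errorProb PY PZ) :=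
  ⟨0, by rintro _ ⟨c, rfl⟩; exact errorOf_nonneg _ _ _ _⟩

theorem iInf_errorProb_nonneg (n : ℕ) (R : ℝ) (R₀ : WithTop ℝ) :
    0 ≤ ⨅ c : Model1Code X Y Z n R R₀, c.errorProb PY PZ :=
  Real.iInf_nonneg fun _ => errorOf_nonneg _ _ _ _

theorem isBoundedUnder_iInf_errorProb [Nonempty X] {R : ℝ} (hR : 0 ≤ R) :
    IsBoundedUnder (· ≤ ·) atTop
      fun n : ℕ => ⨅ c : Model1Code X Y Z n R ⊤, c.errorProb PY PZ := by
  refine isBoundedUnder_of ⟨1, fun n => ?_⟩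
  obtain ⟨c⟩ := nonempty_model1Code_top (X := X) (Y := Y) (Z := Z) n hR
  exact (ciInf_le (bddBelow_errorProb PY PZ n R ⊤) c).trans
    (errorOf_le_one PY PZ (numMsg_pos hR) _ _)

theorem isCoboundedUnder_iInf_errorProb (R : ℝ) :
    IsCoboundedUnder (· ≤ ·) atTop
      fun n : ℕ => ⨅ c : Model1Code X Y Z n R ⊤, c.errorProb PY PZ :=
  (isBoundedUnder_of ⟨0, fun n => iInf_errorProb_nonneg PY PZ n R ⊤⟩ :
    IsBoundedUnder (· ≥ ·) atTop _).isCoboundedUnder_le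

/-- A real `sSup` is informative only for a bounded set. Counting suffices: `(1 - e) M ≤ |Y × Z|ⁿ`
and `exp (n R) ≤ 2 M` bound `exp R`, with the constant absorbed into the `n`-th power because `2 /
(1 - e) ≥ 1`. -/
theorem bddAbove_achievable [Nonempty X] {ε : ℝ} (hε0 : 0 < ε) (hε : ε < 1) :
    BddAbove {R | 0 ≤ R ∧ limsup (fun n : ℕ => ⨅ c : Model1Code X Y Z n R ⊤,
      c.errorProb PY PZ) atTop ≤ ε} := by
  obtain ⟨e, he, he1⟩ := exists_between hε
  have he' : 0 < 1 - e := by linarith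
  refine ⟨Fintype.card (Y × Z) * (2 / (1 - e)), ?_⟩
  rintro R ⟨hR, hlim⟩
  have h1 := eventually_lt_of_limsup_lt (hlim.trans_lt he)
    (isBoundedUnder_iInf_errorProb PY PZ hR)
  obtain ⟨n, hn, hn0⟩ := (h1.and (eventually_gt_atTop 0)).exists
  have := nonempty_model1Code_top (X := X) (Y := Y) (Z := Z) n hR
  obtain ⟨c, hc⟩ := exists_lt_of_ciInf_lt hn
  have h2 := one_sub_errorOf_mul_le PY PZ (numMsg_pos hR) c.enc fun y z => c.dec (c.relay z) y
  have hc' : errorOf PY PZ c.enc (fun _ y z => c.dec (c.relay z) y) < e := hc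
  have hM : (0 : ℝ) ≤ numMsg n R := Nat.cast_nonneg _
  have h3 : (1 - e) * numMsg n R ≤ (Fintype.card (Y × Z) : ℝ) ^ n :=
    (mul_le_mul_of_nonneg_right (by linarith) hM).trans h2
  have h4 : Real.exp R ^ n ≤ (Fintype.card (Y × Z) * (2 / (1 - e)) : ℝ) ^ n := by
    calc Real.exp R ^ n = Real.exp (n * R) := by rw [← Real.exp_nat_mul]
      _ ≤ 2 * numMsg n R := two_mul_numMsg_ge hR
      _ = ((1 - e) * numMsg n R) * (2 / (1 - e)) := by field_simp
      _ ≤ (Fintype.card (Y × Z) : ℝ) ^ n * (2 / (1 - e)) := by gcongr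
      _ ≤ (Fintype.card (Y × Z) : ℝ) ^ n * (2 / (1 - e)) ^ n := by
          refine mul_le_mul_of_nonneg_left (le_self_pow₀ ?_ hn0.ne') (by positivity)
          rw [le_div_iff₀ he']
          linarith
      _ = _ := (mul_pow _ _ _).symm
  have h5 := le_of_pow_le_pow_left₀ hn0.ne' (by positivity) h4
  linarith [Real.add_one_le_exp R]

variable [Fintype X]

theorem mutInfo_le_epsCapacity [Nonempty X] (S : stdSimplex ℝ X) {ε : ℝ} (hε0 : 0 < ε)
    (hε : ε < 1) : mutInfo S (prodChannel PY PZ) ≤ epsCapacity PY PZ ⊤ ε := by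
  refine le_of_forall_lt fun r hr => ?_
  by_cases hr0 : r < 0
  · exact hr0.trans_le (Real.sSup_nonneg fun R hR => hR.1)
  push Not at hr0
  obtain ⟨R, hrR, hRI⟩ := exists_between hr
  have hR : 0 ≤ R := hr0.trans hrR.le
  refine hrR.trans_le (le_csSup (bddAbove_achievable PY PZ hε0 hε) ⟨hR, ?_⟩)
  refine limsup_le_of_le (isCoboundedUnder_iInf_errorProb PY PZ R) ?_
  filter_upwards [eventually_exists_code S (prodChannel PY PZ) hR hRI hε0] with n hn
  obtain ⟨f, φ, hf⟩ := hn
  obtain ⟨c, hc⟩ := exists_model1Code_top PY PZ hR f φ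
  refine (ciInf_le (bddBelow_errorProb PY PZ n R ⊤) c).trans ?_
  rw [hc]
  exact inv_mul_sum_le (numMsg_pos hR) hf

/-- The direct part of the coding theorem for a relay with unlimited rate. -/
theorem mutInfo_le_capacity [Nonempty X] (S : stdSimplex ℝ X) :
    mutInfo S (prodChannel PY PZ) ≤ capacity PY PZ ⊤ := by
  -- `limUnder` is meaningful only if the limit exists; here monotonicity in `ε` and the lower bound
  -- `I(S)` provide it.
  have hmono : MonotoneOn (fun ε => epsCapacity PY PZ ⊤ ε) (Set.Ioo 0 1) := by
    intro ε hε ε' hε' h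
    rcases Set.eq_empty_or_nonempty {R | 0 ≤ R ∧ limsup (fun n : ℕ => ⨅ c : Model1Code X Y Z n R ⊤,
      c.errorProb PY PZ) atTop ≤ ε} with h0 | h0
    · simp only [epsCapacity]
      rw [h0, Real.sSup_empty]
      exact Real.sSup_nonneg fun R hR => hR.1
    · exact csSup_le_csSup (bddAbove_achievable PY PZ hε'.1 hε'.2) h0
        fun R hR => ⟨hR.1, hR.2.trans h⟩
  have hge : ∀ ε ∈ Set.Ioo (0 : ℝ) 1,
      mutInfo S (prodChannel PY PZ) ≤ epsCapacity PY PZ ⊤ ε := fun ε hε =>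
    mutInfo_le_epsCapacity PY PZ S hε.1 hε.2
  have hlim := hmono.tendsto_nhdsWithin_Ioo_right (Set.nonempty_Ioo.2 one_pos)
    ⟨_, by rintro _ ⟨ε, hε, rfl⟩; exact hge ε hε⟩
  rw [capacity, hlim.limUnder_eq]
  exact ge_of_tendsto hlim (Filter.mem_of_superset (Ioo_mem_nhdsGT one_pos) hge)

end Capacity

/-! ### Simulating Model 1 in Model 2 -/

section Simulation

/-- A randomized map can be replaced by a deterministic one: if the law of `z` is
`k (e w) z * a w (cl z)`, then `z` can be chosen as a function of `e w` and `cl z` without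
increasing the expected cost. -/
theorem exists_deterministic_choice {Ω E C ζ : Type*} [Fintype Ω] [Finite E] [Fintype ζ]
    [Nonempty ζ] (e : Ω → E) (cl : ζ → C) {k : E → ζ → ℝ} (hk : ∀ e z, 0 ≤ k e z) (a : Ω → C → ℝ)
    (G : Ω → ζ → ℝ) :
    ∃ s : E → C → ζ, ∑ w, ∑ z, k (e w) z * a w (cl z) * G w (s (e w) (cl z)) ≤
      ∑ w, ∑ z, k (e w) z * a w (cl z) * G w z := by
  classical
  have := Fintype.ofFinite E
  -- For each oracle value and class, choose the symbol of least total cost over the messages with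
  -- that oracle value.
  have hmin : ∀ (ε : E) (c : C), ∃ z₀, ∀ z, ∑ w with e w = ε, a w c * G w z₀ ≤
      ∑ w with e w = ε, a w c * G w z := fun ε c => Finite.exists_min _
  choose s hs using hmin
  refine ⟨s, ?_⟩
  -- Grouped by oracle value, the weight `k ε z` leaves the sum over messages, so the costs compare
  -- term by term in `ε` and `z`.
  have key : ∀ F : Ω → ζ → ℝ, ∑ w, ∑ z, k (e w) z * a w (cl z) * F w z =
      ∑ ε, ∑ z, k ε z * ∑ w with e w = ε, a w (cl z) * F w z := by
    intro F
    rw [← Finset.sum_fiberwise Finset.univ e]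
    refine Finset.sum_congr rfl fun ε _ => ?_
    rw [Finset.sum_comm]
    refine Finset.sum_congr rfl fun z _ => ?_
    rw [Finset.mul_sum]
    refine Finset.sum_congr rfl fun w hw => ?_
    rw [(Finset.mem_filter.1 hw).2, mul_assoc]
  rw [key, key]
  refine Finset.sum_le_sum fun ε _ => Finset.sum_le_sum fun z _ =>
    mul_le_mul_of_nonneg_left ?_ (hk ε z)
  refine le_trans (le_of_eq (Finset.sum_congr rfl fun w hw => ?_)) (hs ε (cl z) z)
  rw [(Finset.mem_filter.1 hw).2]

variable {X Y Z : Type*} [Fintype X] [Fintype Y] [Fintype Z] {n : ℕ}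

open Classical in
/-- If, for inputs outside `bad`, the likelihood `P x z / m z` only depends on the class of `z`,
then the law of `z` given its class and the oracle letter does not depend on the input. -/
theorem exists_factorization {X Z : Type*} [Fintype Z] (P : X → stdSimplex ℝ Z) (bad : Set X) (s : Setoid Z) {m : Z → ℝ}
    (hm : ∀ z, 0 < m z)
    (h : ∀ x ∉ bad, ∀ z z', s z z' → P x z / m z = P x z' / m z') :
    ∃ (k : Option X → Z → ℝ) (a : X → Quotient s → ℝ), (∀ e z, 0 ≤ k e z) ∧
      ∀ x z, P x z = k (if x ∈ bad then some x else none) z * a x (Quotient.mk s z) := by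
  -- On a bad input `k` is the channel law itself. On the others `k` is `m`, and `a` is the
  -- likelihood ratio at a class representative.
  refine ⟨fun e z => e.elim (m z) fun x => P x z,
    fun x c => if x ∈ bad then 1 else P x c.out / m c.out, fun e z => ?_, fun x z => ?_⟩
  · cases e
    · exact (hm z).le
    · exact stdSimplex.zero_le _ _
  · by_cases hx : x ∈ bad
    · simp [hx]
    · have := h x hx z (Quotient.mk s z).out (Setoid.symm (Quotient.mk_out z))
      simp only [if_neg hx, Option.elim_none]
      rw [← this, mul_div_cancel₀ _ (hm z).ne']

/-- The one-letter factorization multiplies over coordinates, and the deterministic choice is then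
made on whole blocks. The cost `G` can absorb the average over the other receiver's block. -/
theorem exists_simulation {M : ℕ} [Nonempty Z] (P : X → stdSimplex ℝ Z)
    (PZ : X → stdSimplex ℝ Z) (Q : stdSimplex ℝ (Z × Z)) (s : Setoid Z) {m : Z → ℝ}
    (hm : ∀ z, 0 < m z) (h : ∀ x ∉ badInputs PZ Q, ∀ z z', s z z' → P x z / m z = P x z' / m z')
    (enc : Fin M → Fin n → X) (G : Fin M → (Fin n → Z) → ℝ) :
    ∃ σ : (Fin n → Quotient s) → (Fin n → Option X) → (Fin n → Z),
      ∑ w, ∑ z, blockProb P (enc w) z *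
        G w (σ (fun i => Quotient.mk s (z i)) (oracle PZ Q (enc w))) ≤
      ∑ w, ∑ z, blockProb P (enc w) z * G w z := by
  obtain ⟨k, a, hk, hka⟩ := exists_factorization P (badInputs PZ Q) s hm h
  obtain ⟨σ, hσ⟩ := exists_deterministic_choice (fun w => oracle PZ Q (enc w))
    (fun (z : Fin n → Z) i => Quotient.mk s (z i)) (k := fun e z => ∏ i, k (e i) (z i))
    (fun e z => Finset.prod_nonneg fun i _ => hk _ _) (fun w c => ∏ i, a (enc w i) (c i)) G
  refine ⟨fun c e => σ e c, ?_⟩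
  have hb : ∀ w z, blockProb P (enc w) z = (∏ i, k (oracle PZ Q (enc w) i) (z i)) *
      ∏ i, a (enc w i) (Quotient.mk s (z i)) := by
    intro w z
    rw [← Finset.prod_mul_distrib]
    exact Finset.prod_congr rfl fun i _ => hka _ _
  simp only [hb]
  exact hσ

/-- Relay and decoder of the first model can be simulated in the second model. -/
theorem exists_model2Code [Nonempty Z] (P : X → stdSimplex ℝ Z) (Q : stdSimplex ℝ (Z × Z))
    (hsymm : ∀ y z, Q (y, z) = Q (z, y)) (hm : ∀ z, 0 < margSnd Q z) {R : ℝ} {R₀ : WithTop ℝ}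
    (c : Model1Code X Z Z n R R₀) :
    ∃ c' : Model2Code X Q n R R₀, c'.enc = c.enc ∧ c'.errorProb P P ≤ c.errorProb P P := by
  have hZ : ∀ x ∉ badInputs P Q, ∀ z z', eqvZ Q z z' →
      P x z / margSnd Q z = P x z' / margSnd Q z' := by
    intro x hx z z' hz
    by_contra hne
    exact hx ⟨z, z', fun h => hne (h ▸ rfl), hz, hne⟩
  -- Bad inputs are defined through the classes of `z` alone; symmetry of `Q` identifies the two
  -- equivalence relations.
  have hY : ∀ x ∉ badInputs P Q, ∀ z z', eqvY Q z z' →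
      P x z / margSnd Q z = P x z' / margSnd Q z' := by
    intro x hx z z' hz
    refine hZ x hx z z' ?_
    change (fun y => Q (y, z) / margSnd Q z) = fun y => Q (y, z') / margSnd Q z'
    change (fun y => Q (z, y) / margFst Q z) = fun y => Q (z', y) / margFst Q z' at hz
    have hmarg : ∀ z, margFst Q z = margSnd Q z := fun z =>
      Finset.sum_congr rfl fun y _ => hsymm z y
    simpa only [hmarg, hsymm z, hsymm z'] using hz
  obtain ⟨σ, hσ⟩ := exists_simulation P P Q (eqvZ Q) hm hZ c.enc fun w z =>
    ∑ y, blockProb P (c.enc w) y * if c.dec (c.relay z) y = w then 0 else 1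
  -- The cost here already contains the simulated relay, so the two bounds chain.
  obtain ⟨τ, hτ⟩ := exists_simulation P P Q (eqvY Q) hm hY c.enc fun w y =>
    ∑ z, blockProb P (c.enc w) z * if c.dec (c.relay (σ (fun i => Quotient.mk (eqvZ Q) (z i))
      (oracle P Q (c.enc w)))) y = w then 0 else 1
  refine ⟨⟨c.enc, fun z e => c.relay (σ z e), fun v y e => c.dec v (τ y e)⟩, rfl, ?_⟩
  unfold Model2Code.errorProb Model1Code.errorProb errorOf
  refine mul_le_mul_of_nonneg_left ?_ (by positivity)
  simp only [Finset.mul_sum] at hσ hτ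
  have hswap : ∀ F : Fin (numMsg n R) → (Fin n → Z) → (Fin n → Z) → ℝ,
      ∑ w, ∑ y, ∑ z, blockProb P (c.enc w) y * blockProb P (c.enc w) z * F w y z =
      ∑ w, ∑ z, ∑ y, blockProb P (c.enc w) z * (blockProb P (c.enc w) y * F w y z) := by
    intro F
    refine Finset.sum_congr rfl fun w _ => ?_
    rw [Finset.sum_comm]
    exact Finset.sum_congr rfl fun z _ => Finset.sum_congr rfl fun y _ => by ring
  have hassoc : ∀ F : Fin (numMsg n R) → (Fin n → Z) → (Fin n → Z) → ℝ,
      ∑ w, ∑ y, ∑ z, blockProb P (c.enc w) y * blockProb P (c.enc w) z * F w y z =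
      ∑ w, ∑ y, ∑ z, blockProb P (c.enc w) y * (blockProb P (c.enc w) z * F w y z) := by
    intro F
    simp only [mul_assoc]
  rw [hassoc]
  refine hτ.trans ?_
  rw [← hassoc, hswap, hswap]
  exact hσ

end Simulation

/-! ### Empirical input law and Fano's inequality -/

section Converse

variable {A B : Type*} [Fintype A] [Fintype B] {n : ℕ}

/-- The empirical input law of a codebook. -/
theorem exists_empirical {M : ℕ} (hn : 0 < n) (hM : 0 < M) (enc : Fin M → Fin n → A) :
    ∃ S : stdSimplex ℝ A, ∀ g : A → ℝ,
      ∑ a, S a * g a = (n : ℝ)⁻¹ * ((M : ℝ)⁻¹ * ∑ w, ∑ i, g (enc w i)) := by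
  classical
  have key : ∀ g : A → ℝ, ∑ a, ((n : ℝ)⁻¹ * ((M : ℝ)⁻¹ * ∑ w, ∑ i,
      if enc w i = a then (1 : ℝ) else 0)) * g a =
      (n : ℝ)⁻¹ * ((M : ℝ)⁻¹ * ∑ w, ∑ i, g (enc w i)) := by
    intro g
    simp only [mul_assoc, ← Finset.mul_sum]
    congr 2
    simp only [Finset.sum_mul]
    rw [Finset.sum_comm]
    refine Finset.sum_congr rfl fun w _ => ?_
    rw [Finset.sum_comm]
    exact Finset.sum_congr rfl fun i _ => by simp
  refine ⟨⟨fun a => (n : ℝ)⁻¹ * ((M : ℝ)⁻¹ * ∑ w, ∑ i, if enc w i = a then (1 : ℝ) else 0),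
    fun a => ?_, ?_⟩, key⟩
  · have : (0 : ℝ) ≤ ∑ w, ∑ i, if enc w i = a then (1 : ℝ) else 0 :=
      Finset.sum_nonneg fun w _ => Finset.sum_nonneg fun i _ => by split_ifs <;> norm_num
    dsimp only
    positivity
  · have := key fun _ => 1
    simp only [mul_one] at this
    rw [this]
    have hn' : (n : ℝ) ≠ 0 := by positivity
    have hM' : (M : ℝ) ≠ 0 := by positivity
    simp [hn', hM']

theorem sum_prod_mul_apply {p : Fin n → B → ℝ} (hp : ∀ i, ∑ b, p i b = 1) (j : Fin n)
    (g : B → ℝ) : ∑ y : Fin n → B, (∏ i, p i (y i)) * g (y j) = ∑ b, p j b * g b := by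
  classical
  have : ∀ y : Fin n → B, (∏ i, p i (y i)) * g (y j) =
      ∏ i, (p i (y i) * if i = j then g (y i) else 1) := by
    intro y
    rw [Finset.prod_mul_distrib]
    simp
  rw [Finset.sum_congr rfl fun y _ => this y,
    sum_prod_eq_prod_sum fun i b => p i b * if i = j then g b else 1,
    Finset.prod_eq_single j]
  · simp
  · intro i _ hi
    simp [hi, hp]
  · simp

/-- Relative entropy of product distributions is additive. -/
theorem klSum_blockProb {A B : Type*} [Fintype B] (W : A → stdSimplex ℝ B) {T : B → ℝ} (x : Fin n → A)
    (hac : ∀ i b, T b = 0 → W (x i) b = 0) :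
    klSum (blockProb W x) (fun y => ∏ i, T (y i)) = ∑ i, klSum (W (x i)) T := by
  have h1 : klSum (blockProb W x) (fun y => ∏ i, T (y i)) =
      ∑ y, blockProb W x y * ∑ j, (Real.log (W (x j) (y j)) - Real.log (T (y j))) := by
    refine Finset.sum_congr rfl fun y _ => ?_
    by_cases h0 : blockProb W x y = 0
    · rw [h0, zero_mul, zero_mul]
    have hW : ∀ i ∈ Finset.univ, W (x i) (y i) ≠ 0 := Finset.prod_ne_zero_iff.1 h0
    rw [Finset.sum_sub_distrib, ← Real.log_prod hW,
      ← Real.log_prod fun i hi => fun h => hW i hi (hac i _ h)]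
    rfl
  rw [h1]
  simp only [Finset.mul_sum]
  rw [Finset.sum_comm]
  exact Finset.sum_congr rfl fun j _ => sum_prod_mul_apply
    (p := fun i b => W (x i) b) (fun i => stdSimplex.sum_eq_one _) j
    fun b => Real.log (W (x j) b) - Real.log (T b)

/-- A Fano-type converse: a code with `M` words and error probability `p ≤ ε` forces the
codewords' output laws to be far from any fixed law. -/
theorem log_card_le_of_error {β : Type*} [Fintype β] {M : ℕ} (hM : 0 < M) {w : Fin M → β → ℝ}
    (hw0 : ∀ i b, 0 ≤ w i b) (hw1 : ∀ i, ∑ b, w i b = 1) {t : β → ℝ} (ht0 : ∀ b, 0 ≤ t b)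
    (ht1 : ∑ b, t b = 1) (hac : ∀ i b, t b = 0 → w i b = 0) (φ : β → Fin M) {ε : ℝ}
    (hε0 : 0 < ε) (hε1 : ε < 1)
    (he : (M : ℝ)⁻¹ * ∑ i, ∑ b, w i b * (if φ b = i then 0 else 1) ≤ ε) :
    (1 - ε) * Real.log M - Real.binEntropy ε ≤ (M : ℝ)⁻¹ * ∑ i, klSum (w i) t := by
  have hM' : (0 : ℝ) < M := Nat.cast_pos.2 hM
  have hM1 : (1 : ℝ) ≤ M := Nat.one_le_cast.2 hM
  have hε1' : 0 < 1 - ε := by linarith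
  set L := Real.log M with hL
  have hL0 : 0 ≤ L := Real.log_nonneg hM1
  set e := (M : ℝ)⁻¹ * ∑ i, ∑ b, w i b * (if φ b = i then 0 else 1)
  have hent : Real.binEntropy ε = -(ε * Real.log ε) - (1 - ε) * Real.log (1 - ε) := by
    rw [Real.binEntropy, Real.log_inv, Real.log_inv]
    ring
  have hkl : 0 ≤ (M : ℝ)⁻¹ * ∑ i, klSum (w i) t :=
    mul_nonneg (by positivity) (Finset.sum_nonneg fun i _ =>
      klSum_nonneg (hw0 i) ht0 (hac i) (by rw [hw1, ht1]))
  -- The Gibbs bound is affine in the true error `e`; this sign allows replacing `e` by `ε`. In the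
  -- other case the left side of the claim is at most `log ε ≤ 0`.
  by_cases hslope : Real.log ε - L - Real.log (1 - ε) ≤ 0
  swap
  · have h1 : Real.log ε ≤ 0 := Real.log_nonpos hε0.le hε1.le
    rw [hent]
    nlinarith [mul_nonneg hε0.le (neg_nonneg.2 h1)]
  -- A guessed posterior of the message given the output: `1 - ε` on the decoded one, `ε / M` on
  -- each other. Its total mass is at most one, which Gibbs' inequality allows.
  let q : Fin M → β → ℝ := fun i b => if φ b = i then 1 - ε else ε / M
  have hq0 : ∀ i b, 0 < q i b := fun i b => by
    simp only [q]
    split_ifs <;> positivity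
  have hq1 : ∀ b, ∑ i, q i b ≤ 1 := by
    intro b
    have : ∀ i, q i b ≤ (if φ b = i then 1 - ε else 0) + ε / M := fun i => by
      have : 0 < ε / M := by positivity
      simp only [q]
      split_ifs <;> linarith
    refine (Finset.sum_le_sum fun i _ => this i).trans (le_of_eq ?_)
    rw [Finset.sum_add_distrib]
    simp only [Finset.sum_ite_eq, Finset.mem_univ, if_true, Finset.sum_const, Finset.card_univ,
      Fintype.card_fin, nsmul_eq_mul]
    field_simp
    ring
  have hgibbs : 0 ≤ klSum (fun ib : Fin M × β => (M : ℝ)⁻¹ * w ib.1 ib.2)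
      (fun ib => t ib.2 * q ib.1 ib.2) := by
    refine klSum_nonneg (fun ib => mul_nonneg (by positivity) (hw0 _ _))
      (fun ib => mul_nonneg (ht0 _) (hq0 _ _).le) (fun ib h => ?_) ?_
    · rw [hac ib.1 ib.2 ((mul_eq_zero.1 h).resolve_right (hq0 _ _).ne'), mul_zero]
    · rw [Fintype.sum_prod_type, Fintype.sum_prod_type, Finset.sum_comm]
      simp only [← Finset.mul_sum, hw1]
      calc ∑ b, t b * ∑ i, q i b ≤ ∑ b, t b * 1 :=
            Finset.sum_le_sum fun b _ => mul_le_mul_of_nonneg_left (hq1 b) (ht0 b)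
        _ = 1 := by simp [ht1]
        _ ≤ _ := by simp [hM'.ne']
  have hexp : klSum (fun ib : Fin M × β => (M : ℝ)⁻¹ * w ib.1 ib.2)
      (fun ib => t ib.2 * q ib.1 ib.2) = (M : ℝ)⁻¹ * ∑ i, klSum (w i) t - L - Real.log (1 - ε) -
        e * (Real.log ε - L - Real.log (1 - ε)) := by
    have hterm : ∀ i b, (M : ℝ)⁻¹ * w i b * (Real.log ((M : ℝ)⁻¹ * w i b) -
        Real.log (t b * q i b)) = (M : ℝ)⁻¹ * (w i b * (Real.log (w i b) - Real.log (t b))) -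
        (M : ℝ)⁻¹ * (w i b * (L + Real.log (1 - ε))) -
        (M : ℝ)⁻¹ * (w i b * (if φ b = i then 0 else 1) *
          (Real.log ε - L - Real.log (1 - ε))) := by
      intro i b
      by_cases h0 : w i b = 0
      · simp [h0]
      have ht : t b ≠ 0 := fun h => h0 (hac i b h)
      rw [Real.log_mul (inv_ne_zero hM'.ne') h0, Real.log_mul ht (hq0 i b).ne', Real.log_inv]
      simp only [q]
      split_ifs
      · ring
      · rw [Real.log_div hε0.ne' hM'.ne']
        ring
    rw [klSum, Fintype.sum_prod_type]
    simp only [hterm, Finset.sum_sub_distrib, ← Finset.mul_sum, ← Finset.sum_mul, hw1]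
    simp only [klSum, one_mul, Finset.sum_const, Finset.card_univ, Fintype.card_fin,
      nsmul_eq_mul, e]
    rw [inv_mul_cancel_left₀ hM'.ne']
    ring
  rw [hexp] at hgibbs
  have h2 := mul_le_mul_of_nonpos_right he hslope
  rw [hent]
  nlinarith

end Converse

/-! ### Bad letters in the codebook of a good code -/

section Main

variable {X Y Z : Type*} [Fintype X] [Fintype Y] [Fintype Z] {n : ℕ}

theorem le_Delta (PY : X → stdSimplex ℝ Y) (PZ : X → stdSimplex ℝ Z) {Q : stdSimplex ℝ (Y × Z)}
    {δ : ℝ} {S : stdSimplex ℝ X} (hac : ∀ b, Q b = 0 → output S (prodChannel PY PZ) b = 0)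
    (h : klSum (output S (prodChannel PY PZ)) Q ≤ δ) :
    ∑ x, (badInputs PZ Q).indicator (fun x => S x) x ≤ Delta PY PZ Q δ := by
  refine le_csSup ⟨1, ?_⟩ ⟨S, ?_, rfl⟩
  · rintro _ ⟨S', -, rfl⟩
    rw [← stdSimplex.sum_eq_one S']
    exact Finset.sum_le_sum fun x _ =>
      Set.indicator_le_self' (fun x _ => stdSimplex.zero_le S' x) x
  · rw [relEntropy_of_ac hac, EReal.coe_ennreal_ofReal, max_eq_left (klSum_nonneg' hac)]
    exact EReal.coe_le_coe_iff.2 h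

/-- The fraction of bad inputs in the codebook of a good code. -/
theorem badFraction_le (PY : X → stdSimplex ℝ Y) (PZ : X → stdSimplex ℝ Z)
    {Q : stdSimplex ℝ (Y × Z)} {C : ℝ} (hQ0 : ∀ x b, Q b = 0 → prodChannel PY PZ x b = 0)
    (hQ : ∀ x, klSum (prodChannel PY PZ x) Q ≤ C) (hn : 0 < n) {M : ℕ} (hM : 0 < M)
    (hMX : M ≤ Fintype.card X ^ n) (enc : Fin M → Fin n → X)
    (est : (Fin n → Y) → (Fin n → Z) → Fin M) {ε : ℝ} (hε0 : 0 < ε) (hε1 : ε < 1)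
    (he : errorOf PY PZ enc (fun _ => est) ≤ ε) :
    badFraction PZ Q enc ≤ Delta PY PZ Q (C - Real.log M / n + fanoTerm X ε) := by
  classical
  set W := prodChannel PY PZ with hW
  obtain ⟨S, hS⟩ := exists_empirical hn hM enc
  have hnR : (0 : ℝ) < n := Nat.cast_pos.2 hn
  have hMR : (0 : ℝ) < M := Nat.cast_pos.2 hM
  -- Every letter used has positive empirical mass, so the output law of `S` dominates its channel
  -- law.
  have hS0 : ∀ w i, S (enc w i) ≠ 0 := by
    intro w i h
    have h1 := hS fun a => if a = enc w i then 1 else 0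
    simp only [mul_ite, mul_one, mul_zero, Finset.sum_ite_eq', Finset.mem_univ, if_true, h] at h1
    have h2 : (1 : ℝ) ≤ ∑ w', ∑ j, if enc w' j = enc w i then (1 : ℝ) else 0 := by
      have h3 : ∀ w' j, (0 : ℝ) ≤ if enc w' j = enc w i then (1 : ℝ) else 0 := fun w' j => by
        split_ifs <;> norm_num
      refine le_trans ?_ (Finset.single_le_sum (f := fun w' => ∑ j, _)
        (fun w' _ => Finset.sum_nonneg fun j _ => h3 w' j) (Finset.mem_univ w))
      refine le_trans ?_ (Finset.single_le_sum (fun j _ => h3 w j) (Finset.mem_univ i))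
      simp
    have : 0 < (n : ℝ)⁻¹ * ((M : ℝ)⁻¹ * ∑ w', ∑ j, if enc w' j = enc w i then (1 : ℝ) else 0) := by
      positivity
    linarith
  have hbad : badFraction PZ Q enc = ∑ x, (badInputs PZ Q).indicator (fun x => S x) x := by
    rw [badFraction, ← hS]
    refine Finset.sum_congr rfl fun x _ => ?_
    by_cases hx : x ∈ badInputs PZ Q <;> simp [hx]
  rw [hbad]
  refine le_Delta PY PZ (fun b hb => ?_) ?_
  · rw [output_apply]
    exact Finset.sum_eq_zero fun x _ => by rw [hQ0 x b hb, mul_zero]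
  rw [errorOf_eq_sum] at he
  -- The reference is the product of the single-letter outputs of `S`, for which the average
  -- divergence is exactly `n I(S)`.
  have h1 := log_card_le_of_error hM (w := fun w => blockProb W (enc w))
    (t := fun y => ∏ i, output S W (y i)) (fun w => blockProb_nonneg W (enc w))
    (fun w => sum_blockProb W (enc w))
    (fun y => Finset.prod_nonneg fun i _ => stdSimplex.zero_le _ _)
    (sum_prod_eq_one (stdSimplex.sum_eq_one _))
    (fun w y hy => by
      obtain ⟨i, hi, h0⟩ := Finset.prod_eq_zero_iff.1 hy
      exact Finset.prod_eq_zero hi (output_ac (hS0 w i) h0))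
    (fun b => est (fun i => (b i).1) fun i => (b i).2) hε0 hε1 he
  have h2 : (M : ℝ)⁻¹ * ∑ w, klSum (blockProb W (enc w)) (fun y => ∏ i, output S W (y i)) =
      n * mutInfo S W := by
    rw [mutInfo, hS, mul_inv_cancel_left₀ hnR.ne']
    congr 1
    exact Finset.sum_congr rfl fun w _ =>
      klSum_blockProb W (enc w) fun i b hb => output_ac (hS0 w i) hb
  rw [h2] at h1
  have h3 : mutInfo S W + klSum (output S W) Q ≤ C := by
    rw [← sum_klSum_eq]
    calc _ ≤ ∑ x, S x * C :=
          Finset.sum_le_sum fun x _ => mul_le_mul_of_nonneg_left (hQ x) (stdSimplex.zero_le S x)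
      _ = C := by rw [← Finset.sum_mul, stdSimplex.sum_eq_one, one_mul]
  have h4 : Real.log M ≤ n * Real.log (Fintype.card X) := by
    rw [← Real.log_pow]
    exact Real.log_le_log hMR (by exact_mod_cast hMX)
  have h5 : 0 ≤ Real.binEntropy ε := Real.binEntropy_nonneg hε0.le hε1.le
  -- Here `M ≤ |X|ⁿ` turns `ε log M / n` into `ε log |X|`, and `n ≥ 1` gives `H(ε) / n ≤ H(ε)`.
  have h6 : Real.log M / n - fanoTerm X ε ≤ mutInfo S W := by
    rw [fanoTerm, sub_le_iff_le_add, div_le_iff₀ hnR]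
    have h7 : (1 : ℝ) ≤ n := Nat.one_le_cast.2 hn
    nlinarith [mul_le_mul_of_nonneg_left h4 hε0.le, mul_le_mul_of_nonneg_right h7 h5]
  linarith

end Main

end RelayChannel

/-! ### Assembly of the proposition -/

theorem mainTheorem10 {X Z : Type*} [Fintype X] [Fintype Z]
    -- the channel `P_{Y|X} = P_{Z|X}`, every output letter of which can occur
    (P : X → stdSimplex ℝ Z) (hP : ∀ z, ∃ x, 0 < P x z)
    (Q : stdSimplex ℝ (Z × Z))
    (hQ : RelayChannel.IsCapacityAchievingOutput (RelayChannel.prodChannel P P) Q)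
    (R R₀ : ℝ) (hR : 0 < R) (hR₀ : 0 < R₀) (n : ℕ) (hn : 0 < n)
    (ε : ℝ) (hε₀ : 0 < ε) (hε₁ : ε < 1)
    (c : RelayChannel.Model1Code X Z Z n R (R₀ : WithTop ℝ)) (hc : c.errorProb P P ≤ ε) :
    ∃ c' : RelayChannel.Model2Code X Q n R (R₀ : WithTop ℝ),
      c'.enc = c.enc ∧ c'.errorProb P P ≤ ε ∧
      (RelayChannel.numMsg n R ≤ Fintype.card X ^ n →
        RelayChannel.badFraction P Q c'.enc ≤
          RelayChannel.Delta P P Q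
            (RelayChannel.capacity P P ⊤ - Real.log (RelayChannel.numMsg n R) / n
              + RelayChannel.fanoTerm X ε)) := by
  open RelayChannel in
  have hM : 0 < numMsg n R := numMsg_pos hR.le
  have : Nonempty X := ⟨c.enc ⟨0, hM⟩ ⟨0, hn⟩⟩
  have : Nonempty Z := by
    by_contra h
    rw [not_nonempty_iff] at h
    simpa using stdSimplex.sum_eq_one (P (Classical.arbitrary X))
  obtain ⟨S, hS, hk⟩ := hQ.exists_input
  have happly : ∀ x y z, prodChannel P P x (y, z) = P x y * P x z := fun _ _ _ => rfl
  have hsymm : ∀ y z, Q (y, z) = Q (z, y) := by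
    intro y z
    rw [← hS, output_apply, output_apply]
    exact Finset.sum_congr rfl fun x _ => by rw [happly, happly, mul_comm (P x y)]
  -- `Q` dominates every `prodChannel P P x`, so `Q (z, z) = 0` would force `P x z ^ 2 = 0`.
  have hm : ∀ z, 0 < margSnd Q z := by
    intro z
    obtain ⟨x, hx⟩ := hP z
    refine Finset.sum_pos' (fun y _ => stdSimplex.zero_le Q _) ⟨z, Finset.mem_univ z, ?_⟩
    refine (stdSimplex.zero_le Q _).lt_of_ne' fun h => ?_
    have h1 := (hk x).1 _ h
    rw [happly] at h1
    exact (mul_pos hx hx).ne' h1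
  obtain ⟨c', henc, herr⟩ := exists_model2Code P Q hsymm hm c
  refine ⟨c', henc, herr.trans hc, fun hMX => ?_⟩
  rw [henc]
  exact badFraction_le P P (fun x => (hk x).1)
    (fun x => (hk x).2.trans (mutInfo_le_capacity P P S)) hn hM hMX c.enc _ hε₀ hε₁ hc
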